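/- For a positive integer $n$, an increasing tree of size $n$ is a planar binary tree with $n$ nodes labeled $1,2,\dots,n$, in which each node has at most one left child and at most one right child and its label is smaller than the labels of its children. Its rightmost node is reached from the root by going to the right child as long as there is one. The tree is called complete if every node is either a leaf or has two children, except that, when $n$ is even, the rightmost node has one left child and no right child. Let $\mathfrak T_n$ be the set of complete increasing trees of size $n$; those of even size are called secant trees. The minimal chain of $t\in\mathfrak T_n$ starts at the root and goes from each interior node to its child with the smallest label (to its only child, if there is just one), until a leaf is reached; the label of that leaf is denoted by $\mathrm{eoc}(t)$. For $n\ge 2$, let $\mathrm{pom}(t)$ be the label of the parent of the leaf labeled $n$. Put $$f_{2n}(m,k):=\#\{t\in\mathfrak T_{2n}:\ \mathrm{eoc}(t)=m \text{ and } \mathrm{pom}(t)=k\},$$ $$\Delta_m f_{2n}(m,k):=f_{2n}(m+1,k)-f_{2n}(m,k),\qquad \Delta_k f_{2n}(m,k):=f_{2n}(m,k+1)-f_{2n}(m,k).$$ **Theorem 1.1.** The following two systems of finite difference equations hold: $$\Delta_m^2 f_{2n}(m,k)+4f_{2n-2}(m,k-2)=0\qquad(2\le m\le k-3<k\le 2n-1),\tag{R1}$$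 $$\Delta_k^2 f_{2n}(m,k)+4f_{2n-2}(m,k)=0\qquad(2\le m\le k-1<k\le 2n-3).\tag{R2}$$ -/

import Mathlib

/-!
Secant trees are modelled on Mathlib's `BinaryTree ℕ`: `nil` is the empty tree, and
`node a l r` is a node labelled `a` with left subtree `l` and right subtree `r`, so that a node
has a left (right) child iff its left (right) subtree is not `nil`.
-/

namespace SecantTree

open BinaryTree

/-- The labels of a tree, read by projecting its nodes onto a horizontal axis, from left to
right. -/
def inorder : BinaryTree ℕ → List ℕ
  | nil => []
  | node a l r => inorder l ++ a :: inorder r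

/-- The label of the root, if the tree is not empty. -/
def root? : BinaryTree ℕ → Option ℕ
  | nil => none
  | node a _ _ => some a

/-- The label of each node is smaller than the labels of its children. -/
def LabelsIncrease : BinaryTree ℕ → Prop
  | nil => True
  | node a l r =>
      (∀ b, root? l = some b → a < b) ∧ (∀ b, root? r = some b → a < b) ∧
        LabelsIncrease l ∧ LabelsIncrease r

/-- Increasing (planar, binary) trees with `n` nodes, labelled `1, 2, …, n`. (For `n ≥ 1` the root
is then labelled `1`.) -/
def IsIncreasing (n : ℕ) (t : BinaryTree ℕ) : Prop :=
  (inorder t).Perm (List.range' 1 n) ∧ LabelsIncrease t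

/-- Every node is a leaf or has two children. -/
def IsFull : BinaryTree ℕ → Prop
  | nil => True
  | node _ l r => (l = nil ↔ r = nil) ∧ IsFull l ∧ IsFull r

/-- Every node, except possibly the rightmost one, is a leaf or has two children. The rightmost
node is reached from the root by going to the right child as long as there is one; so a node of
this path that has a right child is not the rightmost node, and must have a left child too. -/
def IsFullExceptRightmost : BinaryTree ℕ → Prop
  | nil => True
  | node _ l r => (r ≠ nil → l ≠ nil) ∧ IsFull l ∧ IsFullExceptRightmost r

/-- The subtree hanging from the rightmost node. -/
def rightmost : BinaryTree ℕ → BinaryTree ℕ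
  | nil => nil
  | node a l nil => node a l nil
  | node _ _ (node b l' r') => rightmost (node b l' r')

/-- Complete increasing trees with `n` nodes: every node is a leaf or has two children, except that
the rightmost node has one left child and no right child when `n` is even. (The rightmost node never
has a right child.) For even `n ≥ 2` these are the secant trees. -/
def IsCompleteIncreasing (n : ℕ) (t : BinaryTree ℕ) : Prop :=
  IsIncreasing n t ∧ IsFullExceptRightmost t ∧ ((rightmost t).left ≠ nil ↔ Even n)

/-- The set `𝔗ₙ` of complete increasing trees of size `n`. -/
def completeTrees (n : ℕ) : Set (BinaryTree ℕ) :=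
  {t | IsCompleteIncreasing n t}

/-- The end of the minimal chain: starting from the root, go from each interior node to its child
with the smallest label, until a leaf is reached. (The value `0` on the empty tree is not used.) -/
def eoc : BinaryTree ℕ → ℕ
  | nil => 0
  | node a nil nil => a
  | node _ (node b l r) nil => eoc (node b l r)
  | node _ nil (node c l' r') => eoc (node c l' r')
  | node _ (node b l r) (node c l' r') =>
      if b < c then eoc (node b l r) else eoc (node c l' r')

/-- The label of the parent of the node labelled `x`, if there is one. -/
def parent? (x : ℕ) : BinaryTree ℕ → Option ℕ
  | nil => none
  | node a l r =>
      if root? l = some x ∨ root? r = some x then some a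
      else (parent? x l).or (parent? x r)

/-- The parent of the maximum leaf: in a tree of size `n` with labels `1, …, n`, the label of the
parent of the leaf labelled `n`. (The value `0` if there is no parent, i.e. `n ≤ 1`, is not
used.) -/
def pom (t : BinaryTree ℕ) : ℕ :=
  (parent? t.numNodes t).getD 0

/-- `f n m k` is the number of complete increasing trees of size `n` with `eoc = m` and
`pom = k`. -/
noncomputable def f (n m k : ℕ) : ℤ :=
  ({t ∈ completeTrees n | eoc t = m ∧ pom t = k}.ncard : ℤ)

/-- The partial difference with respect to the first variable `m`. -/
def diffM (g : ℕ → ℕ → ℤ) (m k : ℕ) : ℤ := g (m + 1) k - g m k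

/-- The partial difference with respect to the second variable `k`. -/
def diffK (g : ℕ → ℕ → ℤ) (m k : ℕ) : ℤ := g m (k + 1) - g m k

/-- There are finitely many trees of bounded height with labels in a finite set. -/
theorem finite_height_le (s : Set ℕ) (hs : s.Finite) (h : ℕ) :
    {t : BinaryTree ℕ | t.height ≤ h ∧ ∀ x ∈ inorder t, x ∈ s}.Finite := by
  induction h with
  | zero =>
    refine (Set.finite_singleton nil).subset ?_
    rintro (_ | ⟨a, l, r⟩) ⟨h1, -⟩
    · rfl
    · simp at h1
  | succ h ih =>
    refine (((hs.prod (ih.prod ih)).image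
      (fun p : ℕ × BinaryTree ℕ × BinaryTree ℕ => node p.1 p.2.1 p.2.2)).insert nil).subset ?_
    rintro (_ | ⟨a, l, r⟩) ⟨h1, h2⟩
    · exact Or.inl rfl
    · simp only [height, add_le_add_iff_right, sup_le_iff] at h1
      simp only [inorder, List.mem_append, List.mem_cons] at h2
      exact Or.inr ⟨(a, l, r), ⟨h2 a (by simp), ⟨h1.1, fun x hx => h2 x (by simp [hx])⟩,
        ⟨h1.2, fun x hx => h2 x (by simp [hx])⟩⟩, rfl⟩

theorem length_inorder (t : BinaryTree ℕ) : (inorder t).length = t.numNodes := by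
  induction t with
  | nil => rfl
  | node a l r hl hr => simp [inorder, hl, hr]; omega

/-- The set of complete increasing trees of size `n` is finite, so that the numbers `f n m k` are
true cardinalities. -/
theorem completeTrees_finite (n : ℕ) : (completeTrees n).Finite := by
  refine (finite_height_le {x | x < n + 1} (Set.finite_lt_nat _) n).subset ?_
  rintro t ⟨⟨hp, -⟩, -⟩
  refine ⟨?_, fun x hx => ?_⟩
  · have := hp.length_eq
    rw [length_inorder, List.length_range'] at this
    exact this ▸ t.height_le_numNodes
  · have := hp.mem_iff.1 hx
    simp only [List.mem_range'_1] at this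
    simp only [Set.mem_ofPred_eq]
    omega

end SecantTree

/-!
Let `y` and `z` be labels missing from a complete increasing tree, and let `x` be one of its nodes.
There are four ways to insert `y` as a child of `x` and `z` as a leaf below `y` (growths), and two
ways to insert `y` and the leaf `z` as the two children of `x` (pushes). Completeness is the parity
condition that each node is a leaf or has a left subtree of odd size, so the parities of the two
subtrees of `x` determine which of these insertions give a complete tree: the number of growths
minus the number of pushes is `2` if `x` is interior and `-2` if `x` is a leaf.

In a first difference of `f N`, exchanging `k` and `k + 1` (respectively `m` and `m + 1`) cancels
all trees except those in which the two labels are close together. For `diffK` the survivors are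
the growths and pushes of `y = k + 1` and `z = N` at `x = k`; for `diffM` they are the growths of
`(y, z) = (m, m + 1)` and the pushes of `(y, z) = (m + 1, m)` at the last node `x` below `m` on the
minimal chain. Removing the two labels expresses the first difference as
`2 · #(all trees) - 4 · #(trees in which x is a leaf)` on `N - 2` labels. The second difference of
the term with the factor `4` is computed directly for `diffM`, where `x` is a leaf iff `eoc < m`;
for `diffK` the leaves `k` and `k + 1` are exchanged again, and in the remaining trees `k + 1` is a
leaf below `k` and can be moved to the top of the label range.
-/

namespace SecantTree

open BinaryTree

/-! ### Subtrees, children and completeness -/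

/-- The multiset of the labels of a tree. -/
def labels : BinaryTree ℕ → Multiset ℕ
  | nil => 0
  | node a l r => a ::ₘ (labels l + labels r)

theorem labels_eq_coe_inorder (t : BinaryTree ℕ) : labels t = (inorder t : Multiset ℕ) := by
  induction t with
  | nil => rfl
  | node a l r hl hr =>
    simp only [labels, inorder, hl, hr, Multiset.coe_add, Multiset.cons_coe, Multiset.coe_eq_coe]
    exact List.perm_middle.symm

theorem card_labels (t : BinaryTree ℕ) : Multiset.card (labels t) = t.numNodes := by
  rw [labels_eq_coe_inorder, Multiset.coe_card, length_inorder]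

theorem eq_node_of_root? {t : BinaryTree ℕ} {a : ℕ} (h : root? t = some a) :
    ∃ l r, t = node a l r := by
  cases t with
  | nil => simp [root?] at h
  | node b l r => exact ⟨l, r, by simpa [root?] using h⟩

theorem mem_labels_of_root? {t : BinaryTree ℕ} {b : ℕ} (h : root? t = some b) : b ∈ labels t := by
  obtain ⟨l, r, rfl⟩ := eq_node_of_root? h
  simp [labels]

theorem root?_eq_none {t : BinaryTree ℕ} : root? t = none ↔ t = nil := by
  cases t <;> simp [root?]

theorem nodup_labels_node {a : ℕ} {l r : BinaryTree ℕ} :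
    (labels (node a l r)).Nodup ↔ (a ∉ labels l ∧ a ∉ labels r) ∧
      (labels l).Nodup ∧ (labels r).Nodup ∧ ∀ b ∈ labels l, b ∉ labels r := by
  simp only [labels, Multiset.nodup_cons, Multiset.nodup_add, Multiset.mem_add, not_or,
    Multiset.disjoint_left]

/-- `IsSubtree s t`: the tree `s` consists of a node of `t` and all its descendants, or both trees
are empty. -/
def IsSubtree (s : BinaryTree ℕ) : BinaryTree ℕ → Prop
  | nil => s = nil
  | node a l r => s = node a l r ∨ IsSubtree s l ∨ IsSubtree s r

theorem IsSubtree.refl (t : BinaryTree ℕ) : IsSubtree t t := by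
  cases t with
  | nil => rfl
  | node a l r => exact .inl rfl

theorem IsSubtree.trans {s t u : BinaryTree ℕ} (hst : IsSubtree s t) (htu : IsSubtree t u) :
    IsSubtree s u := by
  induction u with
  | nil => exact htu ▸ hst
  | node a l r hl hr =>
    obtain rfl | h | h := htu
    exacts [hst, .inr (.inl (hl h)), .inr (.inr (hr h))]

theorem IsSubtree.left (a : ℕ) (l r : BinaryTree ℕ) : IsSubtree l (node a l r) :=
  .inr (.inl (.refl l))

theorem IsSubtree.right (a : ℕ) (l r : BinaryTree ℕ) : IsSubtree r (node a l r) :=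
  .inr (.inr (.refl r))

theorem IsSubtree.labels_le {s t : BinaryTree ℕ} (h : IsSubtree s t) : labels s ≤ labels t := by
  induction t with
  | nil => exact h ▸ le_rfl
  | node a l r hl hr =>
    obtain rfl | h | h := h
    · exact le_rfl
    · exact (hl h).trans ((Multiset.le_add_right _ _).trans (Multiset.le_cons_self _ _))
    · exact (hr h).trans ((Multiset.le_add_left _ _).trans (Multiset.le_cons_self _ _))

theorem IsSubtree.labels_subset {s t : BinaryTree ℕ} (h : IsSubtree s t) :
    labels s ⊆ labels t :=
  Multiset.subset_of_le h.labels_le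

theorem IsSubtree.mem {x : ℕ} {l r t : BinaryTree ℕ} (h : IsSubtree (node x l r) t) :
    x ∈ labels t :=
  h.labels_subset (by simp [labels])

/-- The left and right subtrees of a node labelled `x`; a pair of empty trees if there is none. -/
def subtreesAt (x : ℕ) : BinaryTree ℕ → BinaryTree ℕ × BinaryTree ℕ
  | nil => (nil, nil)
  | node a l r => if a = x then (l, r) else if x ∈ labels l then subtreesAt x l else subtreesAt x r

theorem isSubtree_subtreesAt {x : ℕ} {t : BinaryTree ℕ} (hx : x ∈ labels t) :
    IsSubtree (node x (subtreesAt x t).1 (subtreesAt x t).2) t := by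
  induction t with
  | nil => simp [labels] at hx
  | node a l r hl hr =>
    simp only [labels, Multiset.mem_cons, Multiset.mem_add] at hx
    simp only [subtreesAt]
    split_ifs with ha hxl
    · exact .inl (by rw [ha])
    · exact .inr (.inl (hl hxl))
    · exact .inr (.inr (hr (by grind)))

theorem IsSubtree.unique {x : ℕ} {l l' r r' t : BinaryTree ℕ} (ht : (labels t).Nodup)
    (h : IsSubtree (node x l r) t) (h' : IsSubtree (node x l' r') t) : l = l' ∧ r = r' := by
  induction t with
  | nil => simp [IsSubtree] at h
  | node a t₁ t₂ h₁ h₂ =>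
    obtain ⟨ha, ht₁, ht₂, hdisj⟩ := nodup_labels_node.1 ht
    rw [IsSubtree, node.injEq] at h h'
    obtain ⟨rfl, rfl, rfl⟩ | h | h := h <;> obtain ⟨hx, rfl, rfl⟩ | h' | h' := h'
    · exact ⟨rfl, rfl⟩
    · exact absurd h'.mem ha.1
    · exact absurd h'.mem ha.2
    · exact absurd (hx ▸ h.mem) ha.1
    · exact h₁ ht₁ h h'
    · exact absurd h'.mem (hdisj _ h.mem)
    · exact absurd (hx ▸ h.mem) ha.2
    · exact absurd h.mem (hdisj _ h'.mem)
    · exact h₂ ht₂ h h'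

/-- `IsChild a b t`: in the tree `t`, a node labelled `b` is a child of a node labelled `a`. -/
def IsChild (a b : ℕ) (t : BinaryTree ℕ) : Prop :=
  ∃ l r, IsSubtree (node a l r) t ∧ (root? l = some b ∨ root? r = some b)

/-- `IsLeaf a t`: no node labelled `a` of the tree `t` has a child. -/
def IsLeaf (a : ℕ) (t : BinaryTree ℕ) : Prop :=
  ∀ b, ¬ IsChild a b t

theorem not_isChild_nil {a b : ℕ} : ¬ IsChild a b nil := by
  rintro ⟨l, r, h, -⟩
  simp [IsSubtree] at h

theorem isChild_node {a b x : ℕ} {l r : BinaryTree ℕ} :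
    IsChild a b (node x l r) ↔
      (a = x ∧ (root? l = some b ∨ root? r = some b)) ∨ IsChild a b l ∨ IsChild a b r := by
  constructor
  · rintro ⟨l', r', h | h | h, hb⟩
    · simp only [node.injEq] at h
      obtain ⟨rfl, rfl, rfl⟩ := h
      exact .inl ⟨rfl, hb⟩
    exacts [.inr (.inl ⟨l', r', h, hb⟩), .inr (.inr ⟨l', r', h, hb⟩)]
  · rintro (⟨rfl, hb⟩ | ⟨l', r', h, hb⟩ | ⟨l', r', h, hb⟩)
    exacts [⟨l, r, .refl _, hb⟩, ⟨l', r', .inr (.inl h), hb⟩, ⟨l', r', .inr (.inr h), hb⟩]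

theorem IsChild.of_isSubtree {a b : ℕ} {s t : BinaryTree ℕ} (h : IsChild a b s)
    (hst : IsSubtree s t) : IsChild a b t :=
  let ⟨l, r, hs, hb⟩ := h
  ⟨l, r, hs.trans hst, hb⟩

theorem isChild_iff_of_isSubtree {x b : ℕ} {l r t : BinaryTree ℕ} (ht : (labels t).Nodup)
    (h : IsSubtree (node x l r) t) : IsChild x b t ↔ root? l = some b ∨ root? r = some b := by
  refine ⟨?_, fun hb => ⟨l, r, h, hb⟩⟩
  rintro ⟨l', r', h', hb⟩
  obtain ⟨rfl, rfl⟩ := h.unique ht h'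
  exact hb

theorem isChild_iff_of_mem {a b : ℕ} {s t : BinaryTree ℕ} (ht : (labels t).Nodup)
    (hst : IsSubtree s t) (ha : a ∈ labels s) : IsChild a b t ↔ IsChild a b s := by
  have hsub := isSubtree_subtreesAt ha
  refine ⟨fun h => ⟨_, _, hsub, ?_⟩, fun h => h.of_isSubtree hst⟩
  exact (isChild_iff_of_isSubtree ht (hsub.trans hst)).1 h

theorem isLeaf_iff_of_isSubtree {x : ℕ} {l r t : BinaryTree ℕ} (ht : (labels t).Nodup)
    (h : IsSubtree (node x l r) t) : IsLeaf x t ↔ l = nil ∧ r = nil := by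
  simp only [IsLeaf, isChild_iff_of_isSubtree ht h, not_or, forall_and,
    ← Option.eq_none_iff_forall_ne_some, root?_eq_none]

theorem IsChild.mem_left {a b : ℕ} {t : BinaryTree ℕ} (h : IsChild a b t) : a ∈ labels t :=
  let ⟨_, _, hs, _⟩ := h
  hs.mem

theorem IsChild.mem_right {a b : ℕ} {t : BinaryTree ℕ} (h : IsChild a b t) : b ∈ labels t := by
  obtain ⟨l, r, hs, hb | hb⟩ := h
  · exact hs.labels_subset (by simp [labels, mem_labels_of_root? hb])
  · exact hs.labels_subset (by simp [labels, mem_labels_of_root? hb])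

theorem not_isChild_root {a b : ℕ} {t : BinaryTree ℕ} (ht : (labels t).Nodup)
    (hb : root? t = some b) : ¬ IsChild a b t := by
  obtain ⟨l, r, rfl⟩ := eq_node_of_root? hb
  obtain ⟨⟨hl, hr⟩, -⟩ := nodup_labels_node.1 ht
  rw [isChild_node]
  rintro (⟨rfl, h | h⟩ | h | h)
  exacts [hl (mem_labels_of_root? h), hr (mem_labels_of_root? h), hl h.mem_right, hr h.mem_right]

theorem IsChild.parent_unique {t : BinaryTree ℕ} {a a' b : ℕ} (ht : (labels t).Nodup)
    (h : IsChild a b t) (h' : IsChild a' b t) : a = a' := by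
  induction t with
  | nil => exact absurd h not_isChild_nil
  | node x l r hl hr =>
    obtain ⟨-, hnl, hnr, hdisj⟩ := nodup_labels_node.1 ht
    have hroot {s : BinaryTree ℕ} {c : ℕ} := @mem_labels_of_root? s c
    have hroot' {s : BinaryTree ℕ} {c d : ℕ} := @not_isChild_root c d s
    have hmem {s : BinaryTree ℕ} {c d : ℕ} := @IsChild.mem_right c d s
    rw [isChild_node] at h h'
    grind

theorem isChild_of_parent? {x k : ℕ} {t : BinaryTree ℕ} (h : parent? x t = some k) :
    IsChild k x t := by
  induction t with
  | nil => simp [parent?] at h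
  | node a l r hl hr =>
    rw [isChild_node]
    rw [parent?] at h
    split_ifs at h with hx
    · exact .inl ⟨(Option.some.inj h).symm, hx⟩
    · obtain h | ⟨-, h⟩ := Option.or_eq_some_iff.1 h
      exacts [.inr (.inl (hl h)), .inr (.inr (hr h))]

theorem IsChild.isSome_parent? {x k : ℕ} {t : BinaryTree ℕ} (h : IsChild k x t) :
    (parent? x t).isSome := by
  induction t with
  | nil => exact absurd h not_isChild_nil
  | node a l r hl hr =>
    rw [parent?]
    split_ifs with hx
    · rfl
    · obtain ⟨-, h⟩ | h | h := isChild_node.1 h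
      · exact absurd h hx
      · simp [hl h]
      · simp [hr h]

theorem parent?_eq_some {x k : ℕ} {t : BinaryTree ℕ} (ht : (labels t).Nodup) :
    parent? x t = some k ↔ IsChild k x t := by
  refine ⟨isChild_of_parent?, fun h => ?_⟩
  obtain ⟨k', hk'⟩ := Option.isSome_iff_exists.1 h.isSome_parent?
  rw [hk', (isChild_of_parent? hk').parent_unique ht h]

theorem labelsIncrease_iff {t : BinaryTree ℕ} :
    LabelsIncrease t ↔ ∀ a b, IsChild a b t → a < b := by
  induction t with
  | nil => simp [LabelsIncrease, not_isChild_nil]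
  | node x l r hl hr =>
    simp only [LabelsIncrease, isChild_node, hl, hr]
    grind

theorem LabelsIncrease.lt {a b : ℕ} {t : BinaryTree ℕ} (h : LabelsIncrease t)
    (hab : IsChild a b t) : a < b :=
  labelsIncrease_iff.1 h a b hab

theorem LabelsIncrease.of_isSubtree {s t : BinaryTree ℕ} (h : LabelsIncrease t)
    (hst : IsSubtree s t) : LabelsIncrease s :=
  labelsIncrease_iff.2 fun _ _ hab => h.lt (hab.of_isSubtree hst)

theorem LabelsIncrease.root_le {t : BinaryTree ℕ} (h : LabelsIncrease t) {a b : ℕ}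
    (ha : root? t = some a) (hb : b ∈ labels t) : a ≤ b := by
  induction t generalizing a with
  | nil => simp [root?] at ha
  | node x l r hl hr =>
    obtain rfl : x = a := by simpa [root?] using ha
    obtain ⟨h₁, h₂, h₃, h₄⟩ := h
    simp only [labels, Multiset.mem_cons, Multiset.mem_add] at hb
    rcases hb with rfl | hb | hb
    · exact le_rfl
    · cases l with
      | nil => simp [labels] at hb
      | node y l₁ l₂ => exact (h₁ y rfl).le.trans (hl h₃ rfl hb)
    · cases r with
      | nil => simp [labels] at hb
      | node y r₁ r₂ => exact (h₂ y rfl).le.trans (hr h₄ rfl hb)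

/-- Completeness as a local parity condition: each node is a leaf or has a left subtree of odd
size. Unlike `IsFullExceptRightmost`, it is inherited by subtrees. -/
def IsComplete : BinaryTree ℕ → Prop
  | nil => True
  | node _ l r => (Odd l.numNodes ∨ (l = nil ∧ r = nil)) ∧ IsComplete l ∧ IsComplete r

theorem IsComplete.of_isSubtree {s t : BinaryTree ℕ} (h : IsComplete t) (hst : IsSubtree s t) :
    IsComplete s := by
  induction t with
  | nil => exact hst ▸ h
  | node a l r hl hr =>
    obtain rfl | hst | hst := hst
    exacts [h, hl h.2.1 hst, hr h.2.2 hst]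

theorem isFull_iff {t : BinaryTree ℕ} :
    IsFull t ↔ IsComplete t ∧ (t = nil ∨ Odd t.numNodes) := by
  induction t with
  | nil => simp [IsFull, IsComplete]
  | node a l r hl hr =>
    have hnil : numNodes (nil : BinaryTree ℕ) = 0 := rfl
    simp only [IsFull, IsComplete, hl, hr, numNodes, Nat.odd_iff, reduceCtorEq, false_or]
    grind

theorem isFullExceptRightmost_iff {t : BinaryTree ℕ} (ht : t ≠ nil) :
    (IsFullExceptRightmost t ∧ ((rightmost t).left ≠ nil ↔ Even t.numNodes)) ↔ IsComplete t := by
  induction t with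
  | nil => exact absurd rfl ht
  | node a l r _ hr =>
    have hnil : numNodes (nil : BinaryTree ℕ) = 0 := rfl
    cases r with
    | nil =>
      simp only [IsFullExceptRightmost, IsComplete, isFull_iff, rightmost, BinaryTree.left,
        numNodes, Nat.odd_iff, Nat.even_iff]
      grind
    | node b l' r' =>
      rw [IsComplete, ← hr (by simp)]
      simp only [IsFullExceptRightmost, isFull_iff, rightmost, numNodes, Nat.odd_iff, Nat.even_iff]
      grind

/-! ### Counting trees -/

/-- The complete increasing trees whose labels are the elements of `S`, each used once. -/
def completeTreesOn (S : Finset ℕ) : Set (BinaryTree ℕ) :=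
  {t | labels t = S.val ∧ LabelsIncrease t ∧ IsComplete t}

section CompleteTreesOn

variable {S : Finset ℕ} {t : BinaryTree ℕ}

theorem mem_labels_of_mem_completeTreesOn (ht : t ∈ completeTreesOn S) {x : ℕ} :
    x ∈ labels t ↔ x ∈ S := by
  rw [ht.1, Finset.mem_val]

theorem nodup_of_mem_completeTreesOn (ht : t ∈ completeTreesOn S) : (labels t).Nodup :=
  ht.1 ▸ S.nodup

theorem completeTreesOn_finite (S : Finset ℕ) : (completeTreesOn S).Finite := by
  refine (finite_height_le S S.finite_toSet S.card).subset ?_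
  intro t ht
  refine ⟨t.height_le_numNodes.trans_eq ?_, fun x hx => ?_⟩
  · rw [← card_labels, ht.1, Finset.card_val]
  · rwa [← Multiset.mem_coe, ← labels_eq_coe_inorder, mem_labels_of_mem_completeTreesOn ht] at hx

/-- The number of complete increasing trees on the labels in `S` that satisfy `P`. -/
noncomputable def count (S : Finset ℕ) (P : BinaryTree ℕ → Prop) : ℤ :=
  ({t ∈ completeTreesOn S | P t}.ncard : ℤ)

theorem count_congr {P Q : BinaryTree ℕ → Prop} (h : ∀ t ∈ completeTreesOn S, P t ↔ Q t) :
    count S P = count S Q := by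
  unfold count
  congr 2
  ext t
  exact and_congr_right (h t)

theorem count_eq_add (P Q : BinaryTree ℕ → Prop) :
    count S P = count S (fun t => P t ∧ Q t) + count S (fun t => P t ∧ ¬ Q t) := by
  have hfin (R : BinaryTree ℕ → Prop) : {t ∈ completeTreesOn S | R t}.Finite :=
    (completeTreesOn_finite S).subset fun _ ht => ht.1
  unfold count
  rw [← Nat.cast_add, ← Set.ncard_union_eq _ (hfin _) (hfin _)]
  · congr 2
    ext t
    simp only [Set.mem_union, Set.mem_ofPred_eq]
    tauto
  · rw [Set.disjoint_left]
    exact fun t h h' => h'.2.2 h.2.2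

theorem count_imp_eq_add (P Q R : BinaryTree ℕ → Prop) :
    count S (fun t => P t ∧ (Q t → R t)) =
      count S (fun t => P t ∧ Q t ∧ R t) + count S (fun t => P t ∧ ¬ Q t) := by
  rw [count_eq_add _ Q]
  congr 1 <;> exact count_congr fun t _ => by tauto

theorem count_exists_eq_sum {ι : Type*} (s : Finset ι) (P : BinaryTree ℕ → Prop)
    {R : ι → BinaryTree ℕ → Prop}
    (h : ∀ t ∈ completeTreesOn S, ∀ i ∈ s, ∀ j ∈ s, R i t → R j t → i = j) :
    count S (fun t => P t ∧ ∃ i ∈ s, R i t) = ∑ i ∈ s, count S (fun t => P t ∧ R i t) := by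
  classical
  have hfin := completeTreesOn_finite S
  have hncard (Q : BinaryTree ℕ → Prop) : count S Q = (hfin.toFinset.filter Q).card := by
    rw [count, ← Set.ncard_coe_finset]
    congr 2
    ext t
    simp
  simp only [hncard]
  rw [← Nat.cast_sum, ← Finset.card_biUnion]
  · congr 2
    ext t
    simp only [Finset.mem_filter, Finset.mem_biUnion]
    grind
  · intro i hi j hj hij
    rw [Function.onFun, Finset.disjoint_left]
    simp only [Finset.mem_filter, Set.Finite.mem_toFinset]
    exact fun t ⟨ht, _, hRi⟩ ⟨_, _, hRj⟩ => hij (h t ht i hi j hj hRi hRj)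

end CompleteTreesOn

theorem mem_completeTrees_iff {n : ℕ} (hn : n ≠ 0) {t : BinaryTree ℕ} :
    t ∈ completeTrees n ↔ t ∈ completeTreesOn (Finset.Icc 1 n) := by
  have hlabels : (inorder t).Perm (List.range' 1 n) ↔ labels t = (Finset.Icc 1 n).val := by
    rw [labels_eq_coe_inorder, ← Multiset.coe_eq_coe]
    rfl
  have hcomplete (ht : labels t = (Finset.Icc 1 n).val) :
      (IsFullExceptRightmost t ∧ ((rightmost t).left ≠ nil ↔ Even n)) ↔ IsComplete t := by
    have hnum : t.numNodes = n := by rw [← card_labels, ht]; simp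
    have hnil : t ≠ nil := by
      rintro rfl
      exact hn hnum.symm
    rw [← isFullExceptRightmost_iff hnil, hnum]
  change (_ ∧ _) ∧ _ ↔ _ ∧ _ ∧ _
  rw [hlabels, and_assoc]
  exact and_congr_right fun ht => and_congr_right fun _ => hcomplete ht

theorem f_eq_count {n m k : ℕ} (hn : n ≠ 0) (hk : k ≠ 0) :
    f n m k = count (Finset.Icc 1 n) (fun t => eoc t = m ∧ IsChild k n t) := by
  unfold f count
  congr 2
  ext t
  simp only [Set.mem_ofPred_eq, mem_completeTrees_iff hn]
  refine and_congr_right fun ht => and_congr_right fun _ => ?_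
  have hnum : t.numNodes = n := by rw [← card_labels, ht.1]; simp
  rw [← parent?_eq_some (nodup_of_mem_completeTreesOn ht), pom, hnum]
  cases parent? n t
  · simp [hk.symm]
  · simp

/-! ### The minimal chain -/

/-- In the tree `t`, `b` is the smallest label of a child of `a`. -/
def IsMinChild (t : BinaryTree ℕ) (a b : ℕ) : Prop :=
  IsChild a b t ∧ ∀ c, IsChild a c t → b ≤ c

/-- The label `x` is on the minimal chain of the tree `t`. -/
def InMinChain (t : BinaryTree ℕ) (x : ℕ) : Prop :=
  ∃ a, root? t = some a ∧ Relation.ReflTransGen (IsMinChild t) a x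

theorem IsMinChild.rightUnique (t : BinaryTree ℕ) : Relator.RightUnique (IsMinChild t) :=
  fun _ b c hb hc => le_antisymm (hb.2 c hc.1) (hc.2 b hb.1)

theorem InMinChain.total {t : BinaryTree ℕ} {x y : ℕ} (hx : InMinChain t x)
    (hy : InMinChain t y) :
    Relation.ReflTransGen (IsMinChild t) x y ∨ Relation.ReflTransGen (IsMinChild t) y x := by
  obtain ⟨a, ha, hax⟩ := hx
  obtain ⟨a', ha', hay⟩ := hy
  obtain rfl : a = a' := Option.some.inj (ha.symm.trans ha')
  exact Relation.ReflTransGen.total_of_right_unique (IsMinChild.rightUnique t) hax hay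

theorem InMinChain.tail {t : BinaryTree ℕ} {x y : ℕ} (hx : InMinChain t x)
    (hxy : IsMinChild t x y) : InMinChain t y :=
  let ⟨a, ha, hax⟩ := hx
  ⟨a, ha, hax.tail hxy⟩

theorem InMinChain.mem {t : BinaryTree ℕ} {x : ℕ} (hx : InMinChain t x) : x ∈ labels t := by
  obtain ⟨a, ha, hax⟩ := hx
  obtain rfl | ⟨p, -, hpx⟩ := hax.cases_tail
  exacts [mem_labels_of_root? ha, hpx.1.mem_right]

theorem InMinChain.root_or_isMinChild {t : BinaryTree ℕ} {x : ℕ} (hx : InMinChain t x) :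
    root? t = some x ∨ ∃ p, InMinChain t p ∧ IsMinChild t p x := by
  obtain ⟨a, ha, hax⟩ := hx
  obtain rfl | ⟨p, hap, hpx⟩ := hax.cases_tail
  exacts [.inl ha, .inr ⟨p, ⟨a, ha, hap⟩, hpx⟩]

theorem LabelsIncrease.le_of_reflTransGen {t : BinaryTree ℕ} (ht : LabelsIncrease t) {a b : ℕ}
    (h : Relation.ReflTransGen (IsMinChild t) a b) : a ≤ b := by
  induction h with
  | refl => exact le_rfl
  | tail _ hbc ih => exact ih.trans (ht.lt hbc.1).le

theorem eoc_node_cases (a : ℕ) (l r : BinaryTree ℕ) :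
    (l = nil ∧ r = nil) ∨ ∃ s b, (s = l ∨ s = r) ∧ root? s = some b ∧
      eoc (node a l r) = eoc s ∧ ∀ c, root? l = some c ∨ root? r = some c → b ≤ c := by
  cases l with
  | nil =>
    cases r with
    | nil => simp
    | node c r₁ r₂ => exact .inr ⟨_, c, .inr rfl, rfl, rfl, by simp [root?]⟩
  | node b l₁ l₂ =>
    cases r with
    | nil => exact .inr ⟨_, b, .inl rfl, rfl, rfl, by simp [root?]⟩
    | node c r₁ r₂ =>
      obtain hbc | hcb := lt_or_ge b c
      · exact .inr ⟨_, b, .inl rfl, rfl, if_pos hbc, by grind [root?]⟩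
      · exact .inr ⟨_, c, .inr rfl, rfl, if_neg hcb.not_gt, by grind [root?]⟩

theorem isLeaf_eoc_and_reflTransGen {t : BinaryTree ℕ} (ht : (labels t).Nodup) {a : ℕ}
    (ha : root? t = some a) :
    IsLeaf (eoc t) t ∧ Relation.ReflTransGen (IsMinChild t) a (eoc t) := by
  induction t generalizing a with
  | nil => simp [root?] at ha
  | node x l r hl hr =>
    obtain rfl : x = a := by simpa [root?] using ha
    obtain ⟨-, hnl, hnr, -⟩ := nodup_labels_node.1 ht
    obtain ⟨rfl, rfl⟩ | ⟨s, b, hs, hb, heoc, hmin⟩ := eoc_node_cases x l r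
    · exact ⟨(isLeaf_iff_of_isSubtree ht (.refl _)).2 ⟨rfl, rfl⟩, .refl⟩
    have hst : IsSubtree s (node x l r) := by
      obtain rfl | rfl := hs
      exacts [.left .., .right ..]
    obtain ⟨hleaf, hchain⟩ :
        IsLeaf (eoc s) s ∧ Relation.ReflTransGen (IsMinChild s) b (eoc s) := by
      obtain rfl | rfl := hs
      exacts [hl hnl hb, hr hnr hb]
    have hchild {p c : ℕ} (hp : p ∈ labels s) : IsChild p c (node x l r) ↔ IsChild p c s :=
      isChild_iff_of_mem ht hst hp
    have hxb : IsMinChild (node x l r) x b := by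
      simp only [IsMinChild, isChild_iff_of_isSubtree ht (.refl _)]
      exact ⟨by grind, hmin⟩
    have hmono (p c : ℕ) (h : IsMinChild s p c) : IsMinChild (node x l r) p c :=
      ⟨(hchild h.1.mem_left).2 h.1, fun d hd => h.2 d ((hchild h.1.mem_left).1 hd)⟩
    have hmem : eoc s ∈ labels s := InMinChain.mem ⟨b, hb, hchain⟩
    rw [heoc]
    exact ⟨fun c hc => hleaf c ((hchild hmem).1 hc),
      .head hxb (Relation.ReflTransGen.mono hmono _ _ hchain)⟩

theorem eoc_eq_iff {t : BinaryTree ℕ} (ht : (labels t).Nodup) (hnil : t ≠ nil) {m : ℕ} :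
    eoc t = m ↔ InMinChain t m ∧ IsLeaf m t := by
  obtain ⟨a, ha⟩ := Option.ne_none_iff_exists'.1 (mt root?_eq_none.1 hnil)
  obtain ⟨hleaf, hchain⟩ := isLeaf_eoc_and_reflTransGen ht ha
  constructor
  · rintro rfl
    exact ⟨⟨a, ha, hchain⟩, hleaf⟩
  · rintro ⟨hm, hmleaf⟩
    obtain h | h := InMinChain.total ⟨a, ha, hchain⟩ hm <;>
      obtain h | ⟨c, hc, -⟩ := h.cases_head
    exacts [h, absurd hc.1 (hleaf c), h.symm, absurd hc.1 (hmleaf c)]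

theorem inMinChain_imp_of_agree {t t' : BinaryTree ℕ} {x : ℕ} (ht : LabelsIncrease t)
    (hroot : ∀ a ≤ x, root? t = some a → root? t' = some a)
    (h : ∀ a b, b ≤ x → (IsChild a b t ↔ IsChild a b t')) (hx : InMinChain t x) :
    InMinChain t' x := by
  obtain ⟨a, ha, hax⟩ := hx
  refine ⟨a, hroot a (ht.le_of_reflTransGen hax) ha, ?_⟩
  clear ha
  induction hax using Relation.ReflTransGen.head_induction_on with
  | refl => exact .refl
  | head hab hbx ih =>
    have hb := ht.le_of_reflTransGen hbx
    refine .head ⟨(h _ _ hb).1 hab.1, fun c hc => ?_⟩ ih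
    by_cases hcx : c ≤ x
    · exact hab.2 c ((h _ _ hcx).2 hc)
    · omega

theorem inMinChain_congr {t t' : BinaryTree ℕ} {x : ℕ} (ht : LabelsIncrease t)
    (ht' : LabelsIncrease t') (hroot : ∀ a ≤ x, root? t = some a ↔ root? t' = some a)
    (h : ∀ a b, b ≤ x → (IsChild a b t ↔ IsChild a b t')) : InMinChain t x ↔ InMinChain t' x :=
  ⟨inMinChain_imp_of_agree ht (fun a ha => (hroot a ha).1) h,
    inMinChain_imp_of_agree ht' (fun a ha => (hroot a ha).2) fun a b hb => (h a b hb).symm⟩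

/-- In the tree `t`, the children of `x` are at least `c`. -/
def ChildrenGe (c x : ℕ) (t : BinaryTree ℕ) : Prop :=
  ∀ b, IsChild x b t → c ≤ b

/-- The label `x` is the last one below `m` on the minimal chain of `t`. -/
def IsLastBelow (m x : ℕ) (t : BinaryTree ℕ) : Prop :=
  InMinChain t x ∧ x < m ∧ ChildrenGe m x t

theorem IsLastBelow.unique {t : BinaryTree ℕ} (ht : LabelsIncrease t) {m x y : ℕ}
    (hx : IsLastBelow m x t) (hy : IsLastBelow m y t) : x = y := by
  have eq_of_chain {u v : ℕ} (hu : IsLastBelow m u t) (hv : IsLastBelow m v t)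
      (huv : Relation.ReflTransGen (IsMinChild t) u v) : u = v := by
    obtain h | ⟨c, huc, hcv⟩ := huv.cases_head
    · exact h
    · exact absurd ((hu.2.2 c huc.1).trans (ht.le_of_reflTransGen hcv)) hv.2.1.not_ge
  obtain h | h := hx.1.total hy.1
  exacts [eq_of_chain hx hy h, (eq_of_chain hy hx h).symm]

theorem exists_isLastBelow {t : BinaryTree ℕ} (ht : LabelsIncrease t) {m a : ℕ}
    (ha : a ∈ labels t) (ham : a < m) : ∃ x, IsLastBelow m x t := by
  classical
  obtain ⟨b, hb⟩ : ∃ b, root? t = some b := by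
    refine Option.ne_none_iff_exists'.1 (mt root?_eq_none.1 ?_)
    rintro rfl
    simp [labels] at ha
  have hne : {x ∈ Finset.range m | InMinChain t x}.Nonempty :=
    ⟨b, Finset.mem_filter.2
      ⟨Finset.mem_range.2 ((ht.root_le hb ha).trans_lt ham), b, hb, .refl⟩⟩
  obtain ⟨x, hx, hmax⟩ := Finset.exists_max_image _ id hne
  simp only [Finset.mem_filter, Finset.mem_range, id] at hx hmax
  refine ⟨x, hx.2, hx.1, fun c hc => ?_⟩
  by_contra! hcm
  have hex : ∃ d, IsChild x d t := ⟨c, hc⟩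
  have hmin : IsMinChild t x (Nat.find hex) :=
    ⟨Nat.find_spec hex, fun d hd => Nat.find_min' hex hd⟩
  exact absurd (ht.lt hmin.1)
    (hmax _ ⟨(hmin.2 c hc).trans_lt hcm, hx.2.tail hmin⟩).not_gt

theorem isLastBelow_eoc {t : BinaryTree ℕ} (ht : (labels t).Nodup) (hnil : t ≠ nil) {m : ℕ}
    (hm : eoc t < m) : IsLastBelow m (eoc t) t := by
  obtain ⟨hchain, hleaf⟩ := (eoc_eq_iff ht hnil).1 rfl
  exact ⟨hchain, hm, fun b hb => absurd hb (hleaf b)⟩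

theorem IsLastBelow.isLeaf_iff {t : BinaryTree ℕ} (ht : (labels t).Nodup)
    (hinc : LabelsIncrease t) (hnil : t ≠ nil) {m x : ℕ} (hx : IsLastBelow m x t) :
    IsLeaf x t ↔ eoc t < m := by
  constructor
  · intro hleaf
    rw [(eoc_eq_iff ht hnil).2 ⟨hx.1, hleaf⟩]
    exact hx.2.1
  · intro hm
    rw [hx.unique hinc (isLastBelow_eoc ht hnil hm)]
    exact ((eoc_eq_iff ht hnil).1 rfl).2

/-! ### Relabelling -/

theorem labels_map (σ : ℕ → ℕ) (t : BinaryTree ℕ) : labels (t.map σ) = (labels t).map σ := by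
  induction t with
  | nil => rfl
  | node a l r hl hr => simp [BinaryTree.map, labels, hl, hr]

theorem root?_map (σ : ℕ → ℕ) (t : BinaryTree ℕ) : root? (t.map σ) = (root? t).map σ := by
  cases t <;> rfl

theorem map_eq_nil {σ : ℕ → ℕ} {t : BinaryTree ℕ} : t.map σ = nil ↔ t = nil := by
  cases t <;> simp [BinaryTree.map]

theorem isComplete_map {σ : ℕ → ℕ} {t : BinaryTree ℕ} : IsComplete (t.map σ) ↔ IsComplete t := by
  induction t with
  | nil => rfl
  | node a l r hl hr =>
    have hnum (s : BinaryTree ℕ) : (s.map σ).numNodes = s.numNodes := by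
      rw [← card_labels, labels_map, Multiset.card_map, card_labels]
    simp only [BinaryTree.map, IsComplete, hl, hr, hnum, map_eq_nil]

theorem map_eq_self {σ : ℕ → ℕ} {t : BinaryTree ℕ} (h : ∀ a ∈ labels t, σ a = a) :
    t.map σ = t := by
  induction t with
  | nil => rfl
  | node a l r hl hr =>
    simp only [labels, Multiset.mem_cons, Multiset.mem_add] at h
    simp only [BinaryTree.map]
    rw [h a (.inl rfl), hl fun b hb => h b (.inr (.inl hb)), hr fun b hb => h b (.inr (.inr hb))]

theorem isChild_map_iff {σ : ℕ → ℕ} {t : BinaryTree ℕ} {a' b' : ℕ} :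
    IsChild a' b' (t.map σ) ↔ ∃ a b, IsChild a b t ∧ σ a = a' ∧ σ b = b' := by
  induction t with
  | nil => simp [BinaryTree.map, not_isChild_nil]
  | node x l r hl hr =>
    simp only [BinaryTree.map, isChild_node, hl, hr, root?_map, Option.map_eq_some_iff]
    grind

section Relabel

variable {σ : ℕ → ℕ} {t : BinaryTree ℕ}

theorem isChild_map_apply_iff (hσ : σ.Injective) {a b : ℕ} :
    IsChild (σ a) (σ b) (t.map σ) ↔ IsChild a b t := by
  simp only [isChild_map_iff, hσ.eq_iff]
  grind

theorem isLeaf_map_apply_iff (hσ : σ.Injective) {a : ℕ} :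
    IsLeaf (σ a) (t.map σ) ↔ IsLeaf a t := by
  simp only [IsLeaf, isChild_map_iff, hσ.eq_iff]
  grind

theorem count_relabel (hσ : σ.Injective) {S S' : Finset ℕ} (hS : S.image σ = S')
    {P P' : BinaryTree ℕ → Prop} (h : ∀ t, labels t = S.val →
      (LabelsIncrease t ∧ P t ↔ LabelsIncrease (t.map σ) ∧ P' (t.map σ))) :
    count S P = count S' P' := by
  have hval : S'.val = S.val.map σ := by rw [← hS, Finset.image_val_of_injOn hσ.injOn]
  have hinv : Function.invFun σ ∘ σ = id := Function.invFun_comp hσ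
  have hleft (t : BinaryTree ℕ) : (t.map σ).map (Function.invFun σ) = t := by
    rw [← BinaryTree.comp_map, hinv, BinaryTree.id_map]
  have hright (t : BinaryTree ℕ) (ht : labels t = S'.val) :
      (t.map (Function.invFun σ)).map σ = t := by
    rw [← BinaryTree.comp_map]
    refine map_eq_self fun a ha => Function.invFun_eq (f := σ) ?_
    rw [ht, hval, Multiset.mem_map] at ha
    exact ha.imp fun b hb => hb.2
  have hlabels (t : BinaryTree ℕ) : labels (t.map σ) = S'.val ↔ labels t = S.val := by
    rw [labels_map, hval, (Multiset.map_injective hσ).eq_iff]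
  have hmem (t : BinaryTree ℕ) : t ∈ completeTreesOn S ∧ P t ↔
      t.map σ ∈ completeTreesOn S' ∧ P' (t.map σ) := by
    simp only [completeTreesOn, Set.mem_ofPred_eq, hlabels, isComplete_map]
    have := h t
    tauto
  unfold count
  rw [← Set.ncard_image_of_injective _ (Function.LeftInverse.injective hleft)]
  congr 2
  ext t
  constructor
  · rintro ⟨s, hs, rfl⟩
    exact (hmem s).1 hs
  · intro ht
    refine ⟨t.map (Function.invFun σ), (hmem _).2 ?_, hright t ht.1.1⟩
    rwa [hright t ht.1.1]

theorem InMinChain.map (hσ : σ.Injective) (ht : LabelsIncrease t) {x : ℕ}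
    (hmono : ∀ p b c, IsChild p b t → IsChild p c t → b ≤ x → b ≤ c → σ b ≤ σ c)
    (hx : InMinChain t x) : InMinChain (t.map σ) (σ x) := by
  obtain ⟨a, ha, hax⟩ := hx
  refine ⟨σ a, by rw [root?_map, ha]; rfl, ?_⟩
  clear ha
  induction hax using Relation.ReflTransGen.head_induction_on with
  | refl => exact .refl
  | head hab hbx ih =>
    refine .head ⟨(isChild_map_apply_iff hσ).2 hab.1, fun c' hc' => ?_⟩ ih
    obtain ⟨a', c, hc, haa, rfl⟩ := isChild_map_iff.1 hc'
    have hac := hσ haa ▸ hc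
    exact hmono _ _ _ hab.1 hac (ht.le_of_reflTransGen hbx) (hab.2 c hac)

theorem nodup_labels_map (hσ : σ.Injective) (hnodup : (labels t).Nodup) :
    (labels (t.map σ)).Nodup := by
  rw [labels_map]
  exact hnodup.map hσ

theorem eoc_map (hσ : σ.Injective) (hnodup : (labels t).Nodup) (hnil : t ≠ nil)
    (ht : LabelsIncrease t)
    (hmono : ∀ p b c, IsChild p b t → IsChild p c t → b ≤ eoc t → b ≤ c → σ b ≤ σ c) :
    eoc (t.map σ) = σ (eoc t) := by
  obtain ⟨hchain, hleaf⟩ := (eoc_eq_iff hnodup hnil).1 rfl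
  rw [eoc_eq_iff (nodup_labels_map hσ hnodup) (mt map_eq_nil.1 hnil)]
  exact ⟨hchain.map hσ ht hmono, (isLeaf_map_apply_iff hσ).2 hleaf⟩

theorem eoc_map_eq_iff (hσ : σ.Injective) (hnodup : (labels t).Nodup) (hnil : t ≠ nil)
    (ht : LabelsIncrease t) (ht' : LabelsIncrease (t.map σ)) {m : ℕ} (hfix : ∀ b ≤ m, σ b = b)
    (hgt : ∀ b, m < b → m < σ b) : eoc (t.map σ) = m ↔ eoc t = m := by
  have hpre {b c : ℕ} (hc : c ≤ m) : σ b = c ↔ b = c := by grind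
  have hleaf := isLeaf_map_apply_iff (t := t) hσ (a := m)
  rw [hfix m le_rfl] at hleaf
  rw [eoc_eq_iff (nodup_labels_map hσ hnodup) (mt map_eq_nil.1 hnil), eoc_eq_iff hnodup hnil, hleaf]
  refine and_congr_left' (inMinChain_congr ht' ht (fun a ha => ?_) fun a b hb => ?_)
  · simp only [root?_map, Option.map_eq_some_iff, hpre ha, exists_eq_right]
  · by_cases ha : a ≤ m
    · conv_lhs => rw [← hfix a ha, ← hfix b hb, isChild_map_apply_iff hσ]
    · exact iff_of_false (fun h => by have := ht'.lt h; omega) fun h => by have := ht.lt h; omega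

theorem labelsIncrease_map_iff_forall :
    LabelsIncrease (t.map σ) ↔ ∀ a b, IsChild a b t → σ a < σ b := by
  simp only [labelsIncrease_iff, isChild_map_iff]
  grind

theorem labelsIncrease_map_iff (hσ : StrictMono σ) :
    LabelsIncrease (t.map σ) ↔ LabelsIncrease t := by
  rw [labelsIncrease_map_iff_forall, labelsIncrease_iff]
  simp only [hσ.lt_iff_lt]

theorem count_relabel_strictMono (hσ : StrictMono σ) {S S' : Finset ℕ} (hS : S.image σ = S')
    {P P' : BinaryTree ℕ → Prop}
    (h : ∀ t, labels t = S.val → LabelsIncrease t → (P t ↔ P' (t.map σ))) :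
    count S P = count S' P' :=
  count_relabel hσ.injective hS fun t ht => by
    rw [labelsIncrease_map_iff hσ]
    exact and_congr_right (h t ht)

end Relabel

theorem ne_nil_of_mem_labels {t : BinaryTree ℕ} {a : ℕ} (ha : a ∈ labels t) : t ≠ nil := by
  rintro rfl
  simp [labels] at ha

theorem ne_nil_of_labels_eq_val {S : Finset ℕ} {t : BinaryTree ℕ} (hS : S.Nonempty)
    (ht : labels t = S.val) : t ≠ nil :=
  let ⟨a, ha⟩ := hS
  ne_nil_of_mem_labels (a := a) (ht ▸ ha)

/-! ### Inserting two nodes below a node -/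

/-- Replaces the two subtrees of a node labelled `x` by the pair `p`. Together with `subtreesAt x`
it forms a lens. -/
def replaceAt (x : ℕ) (p : BinaryTree ℕ × BinaryTree ℕ) : BinaryTree ℕ → BinaryTree ℕ
  | nil => nil
  | node a l r =>
      if a = x then node a p.1 p.2
      else if x ∈ labels l then node a (replaceAt x p l) r
      else node a l (replaceAt x p r)

section ReplaceAt

variable {x : ℕ} {p q : BinaryTree ℕ × BinaryTree ℕ} {t : BinaryTree ℕ}

theorem mem_labels_induction {x : ℕ} {motive : ∀ t, x ∈ labels t → Prop}
    (root : ∀ l r, motive (node x l r) (Multiset.mem_cons_self x _))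
    (left : ∀ a l r (h : x ∈ labels l), a ≠ x → motive l h →
      motive (node a l r) (Multiset.mem_cons_of_mem (Multiset.mem_add.2 (.inl h))))
    (right : ∀ a l r (h : x ∈ labels r), a ≠ x → x ∉ labels l → motive r h →
      motive (node a l r) (Multiset.mem_cons_of_mem (Multiset.mem_add.2 (.inr h))))
    (t : BinaryTree ℕ) (hx : x ∈ labels t) : motive t hx := by
  induction t with
  | nil => exact absurd hx (Multiset.notMem_zero x)
  | node a l r hl hr =>
    have hx' := hx
    simp only [labels, Multiset.mem_cons, Multiset.mem_add] at hx'
    by_cases ha : a = x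
    · subst ha
      exact root l r
    by_cases hxl : x ∈ labels l
    · exact left a l r hxl ha (hl hxl)
    · have hxr : x ∈ labels r := by grind
      exact right a l r hxr ha hxl (hr hxr)

theorem root?_replaceAt : root? (replaceAt x p t) = root? t := by
  cases t with
  | nil => rfl
  | node a l r =>
    simp only [replaceAt]
    split_ifs <;> rfl

theorem mem_labels_replaceAt (hx : x ∈ labels t) : x ∈ labels (replaceAt x p t) := by
  induction t, hx using mem_labels_induction <;> simp_all [replaceAt, labels]

theorem subtreesAt_replaceAt (hx : x ∈ labels t) : subtreesAt x (replaceAt x p t) = p := by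
  induction t, hx using mem_labels_induction <;>
    simp_all [replaceAt, subtreesAt, mem_labels_replaceAt]

theorem replaceAt_replaceAt (hx : x ∈ labels t) :
    replaceAt x p (replaceAt x q t) = replaceAt x p t := by
  induction t, hx using mem_labels_induction <;> simp_all [replaceAt, mem_labels_replaceAt]

theorem replaceAt_subtreesAt (hx : x ∈ labels t) : replaceAt x (subtreesAt x t) t = t := by
  induction t, hx using mem_labels_induction <;> simp_all [replaceAt, subtreesAt]

theorem labels_replaceAt (hx : x ∈ labels t) :
    labels (replaceAt x p t) + (labels (subtreesAt x t).1 + labels (subtreesAt x t).2) =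
      labels t + (labels p.1 + labels p.2) := by
  induction t, hx using mem_labels_induction with
  | root l r =>
    simp only [replaceAt, subtreesAt, labels, if_true, Multiset.cons_add]
    rw [add_comm (labels l + labels r)]
  | left a l r h ha ih =>
    simp only [replaceAt, subtreesAt, labels, h, ha, if_true, if_false, Multiset.cons_add]
    rw [add_right_comm, ih, add_right_comm]
  | right a l r h ha hl ih =>
    simp only [replaceAt, subtreesAt, labels, ha, hl, if_false, Multiset.cons_add]
    rw [add_assoc, ih, ← add_assoc]

theorem LabelsIncrease.replaceAt (ht : LabelsIncrease t) (hx : x ∈ labels t)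
    (hp : LabelsIncrease (node x p.1 p.2)) : LabelsIncrease (replaceAt x p t) := by
  induction t, hx using mem_labels_induction <;>
    simp_all [SecantTree.replaceAt, LabelsIncrease, root?_replaceAt]

theorem numNodes_replaceAt (hx : x ∈ labels t) :
    (replaceAt x p t).numNodes + ((subtreesAt x t).1.numNodes + (subtreesAt x t).2.numNodes) =
      t.numNodes + (p.1.numNodes + p.2.numNodes) := by
  simp only [← card_labels, ← Multiset.card_add, labels_replaceAt hx]

theorem IsComplete.replaceAt (ht : IsComplete t) (hx : x ∈ labels t)
    (hp : IsComplete (node x p.1 p.2))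
    (hparity : Even ((subtreesAt x t).1.numNodes + (subtreesAt x t).2.numNodes) ↔
      Even (p.1.numNodes + p.2.numNodes)) : IsComplete (replaceAt x p t) := by
  induction t, hx using mem_labels_induction with
  | root l r => simpa [SecantTree.replaceAt] using hp
  | left a l r h ha ih =>
    simp only [SecantTree.replaceAt, subtreesAt, h, ha, if_true, if_false] at hparity ⊢
    have hodd := ht.1.resolve_right fun h' => ne_nil_of_mem_labels h h'.1
    have hnum := numNodes_replaceAt (p := p) h
    refine ⟨.inl ?_, ih ht.2.1 hparity, ht.2.2⟩
    grind
  | right a l r h ha hl ih =>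
    simp only [SecantTree.replaceAt, subtreesAt, ha, hl, if_false] at hparity ⊢
    have hodd := ht.1.resolve_right fun h' => ne_nil_of_mem_labels h h'.2
    exact ⟨.inl hodd, ht.2.1, ih ht.2.2 hparity⟩

theorem isChild_replaceAt {a b : ℕ} (ha : a ≠ x) (hx : x ∈ labels t)
    (hp : IsChild a b p.1 ∨ IsChild a b p.2 ↔
      IsChild a b (subtreesAt x t).1 ∨ IsChild a b (subtreesAt x t).2) :
    IsChild a b (replaceAt x p t) ↔ IsChild a b t := by
  induction t, hx using mem_labels_induction <;>
    simp_all [SecantTree.replaceAt, subtreesAt, isChild_node, root?_replaceAt]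

end ReplaceAt

/-- A way of inserting `y` and a leaf `z` below a node `x`. In a growth `z` becomes a child of
`y`, and `y` takes the place of one of the two subtrees of `x`, which becomes its other subtree. In
a push `y` takes over both subtrees of `x`, and `y` and `z` become the children of `x`. The Boolean
values tell whether a node is inserted on the right: `y` and `z` for a growth, `z` for a push. -/
inductive Insertion
  | growth (yRight zRight : Bool)
  | push (zRight : Bool)

/-- The subtrees of `x` after an insertion, as a function of the subtrees before it. -/
def Insertion.apply (y z : ℕ) :
    Insertion → BinaryTree ℕ × BinaryTree ℕ → BinaryTree ℕ × BinaryTree ℕ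
  | growth false false, (l, r) => (node y (node z nil nil) l, r)
  | growth false true, (l, r) => (node y l (node z nil nil), r)
  | growth true false, (l, r) => (l, node y (node z nil nil) r)
  | growth true true, (l, r) => (l, node y r (node z nil nil))
  | push false, (l, r) => (node z nil nil, node y l r)
  | push true, (l, r) => (node y l r, node z nil nil)

namespace Insertion

variable {x y z : ℕ} {i j : Insertion} {p q : BinaryTree ℕ × BinaryTree ℕ}

theorem apply_injective (y z : ℕ) (i : Insertion) : (i.apply y z).Injective := by
  rintro ⟨l, r⟩ ⟨l', r'⟩ h
  rcases i with ⟨_ | _, _ | _⟩ | ⟨_ | _⟩ <;> simp_all [apply]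

theorem labels_apply :
    labels (i.apply y z p).1 + labels (i.apply y z p).2 =
      y ::ₘ z ::ₘ (labels p.1 + labels p.2) := by
  rcases i with ⟨_ | _, _ | _⟩ | ⟨_ | _⟩ <;> simp only [apply, labels] <;>
    simp only [← Multiset.singleton_add] <;> abel

theorem isChild_apply_iff {a b : ℕ} (hy : a ≠ y) (hz : a ≠ z) :
    IsChild a b (i.apply y z p).1 ∨ IsChild a b (i.apply y z p).2 ↔
      IsChild a b p.1 ∨ IsChild a b p.2 := by
  rcases i with ⟨_ | _, _ | _⟩ | ⟨_ | _⟩ <;>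
    simp [apply, isChild_node, hy, hz, not_isChild_nil]

theorem even_numNodes_apply_iff :
    Even ((i.apply y z p).1.numNodes + (i.apply y z p).2.numNodes) ↔
      Even (p.1.numNodes + p.2.numNodes) := by
  simp only [← card_labels, ← Multiset.card_add, labels_apply, Multiset.card_cons]
  grind

theorem isComplete_growth_iff {yRight zRight : Bool} :
    IsComplete (node x ((growth yRight zRight).apply y z p).1
      ((growth yRight zRight).apply y z p).2) ↔
      IsComplete (node x p.1 p.2) ∧ Odd p.1.numNodes ∧
        (yRight = true ∧ zRight = true → Odd p.2.numNodes) := by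
  obtain ⟨l, r⟩ := p
  cases yRight <;> cases zRight <;> simp only [apply, IsComplete, numNodes] <;> grind

theorem isComplete_push_iff {zRight : Bool} :
    IsComplete (node x ((push zRight).apply y z p).1 ((push zRight).apply y z p).2) ↔
      IsComplete (node x p.1 p.2) ∧
        (zRight = true → Odd p.1.numNodes → Odd p.2.numNodes) := by
  obtain ⟨l, r⟩ := p
  have hnil : numNodes (nil : BinaryTree ℕ) = 0 := rfl
  cases zRight <;> simp only [apply, IsComplete, numNodes] <;> grind

theorem isComplete_of_apply (h : IsComplete (node x (i.apply y z p).1 (i.apply y z p).2)) :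
    IsComplete (node x p.1 p.2) := by
  cases i
  exacts [(isComplete_growth_iff.1 h).1, (isComplete_push_iff.1 h).1]

theorem eq_of_apply_eq (h : i.apply y z p = j.apply y z q)
    (hnodup : (y ::ₘ z ::ₘ (labels p.1 + labels p.2)).Nodup) : i = j := by
  obtain ⟨l, r⟩ := p
  obtain ⟨l', r'⟩ := q
  simp only [Multiset.nodup_cons, Multiset.mem_cons, Multiset.mem_add, not_or] at hnodup
  rcases i with ⟨_ | _, _ | _⟩ | ⟨_ | _⟩ <;> rcases j with ⟨_ | _, _ | _⟩ | ⟨_ | _⟩ <;>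
    simp only [apply, Prod.mk.injEq, node.injEq] at h <;> grind [labels]

theorem labelsIncrease_apply_iff {c : ℕ} (hxc : x < c) (hcy : c ≤ y) (hcz : c ≤ z)
    (hi : (∃ zRight, i = push zRight) ∨ y < z)
    (hlt : ∀ b, root? p.1 = some b ∨ root? p.2 = some b → c ≤ b → y < b) :
    (LabelsIncrease (node x (i.apply y z p).1 (i.apply y z p).2) ∧
      ∀ b, root? (i.apply y z p).1 = some b ∨ root? (i.apply y z p).2 = some b → c ≤ b) ↔
      LabelsIncrease (node x p.1 p.2) ∧ ∀ b, root? p.1 = some b ∨ root? p.2 = some b → c ≤ b := by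
  obtain ⟨l, r⟩ := p
  have hnode (a : ℕ) (l r : BinaryTree ℕ) : root? (node a l r) = some a := rfl
  have hnil : root? nil = none := rfl
  rcases i with ⟨_ | _, _ | _⟩ | ⟨_ | _⟩ <;>
    simp only [apply, LabelsIncrease, hnode, hnil, Option.some.injEq, reduceCtorEq, forall_eq',
      or_imp, forall_and, false_imp_iff, implies_true, true_and, and_true] <;>
    grind

end Insertion

/-- The set `F` arises from `S` by adding `y` and `z`, and these two labels may be inserted below
the node `x` of a tree on `S` in which the children of `x` are at least `c`. -/
structure CanInsert (S F : Finset ℕ) (c x y z : ℕ) : Prop where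
  val_eq : F.val = y ::ₘ z ::ₘ S.val
  mem : x ∈ S
  lt_cutoff : x < c
  cutoff_le_left : c ≤ y
  cutoff_le_right : c ≤ z
  left_lt : ∀ b ∈ S, c ≤ b → y < b

/-- On increasing trees, the predicate `P` does not depend on the children of `x`, `y` and `z`. -/
def IgnoresChildren (P : BinaryTree ℕ → Prop) (x y z : ℕ) : Prop :=
  ∀ t t', LabelsIncrease t → LabelsIncrease t' → root? t = root? t' →
    (∀ a b, a ≠ x → a ≠ y → a ≠ z → (IsChild a b t ↔ IsChild a b t')) → (P t ↔ P t')

theorem CanInsert.mem_labels {S F : Finset ℕ} {c x y z : ℕ} {t : BinaryTree ℕ}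
    (h : CanInsert S F c x y z) (ht : t ∈ completeTreesOn F) : x ∈ labels t := by
  rw [ht.1, h.val_eq]
  exact Multiset.mem_cons_of_mem (Multiset.mem_cons_of_mem h.mem)

theorem CanInsert.ne {S F : Finset ℕ} {c x y z : ℕ} (h : CanInsert S F c x y z) : y ≠ z := by
  have hnodup := F.nodup
  simp only [h.val_eq, Multiset.nodup_cons, Multiset.mem_cons, not_or] at hnodup
  exact hnodup.1.1

section IgnoresChildren

variable {P Q : BinaryTree ℕ → Prop} {u v x y z : ℕ}

theorem IgnoresChildren.and (hP : IgnoresChildren P x y z) (hQ : IgnoresChildren Q x y z) :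
    IgnoresChildren (fun t => P t ∧ Q t) x y z :=
  fun t t' ht ht' hroot h => and_congr (hP t t' ht ht' hroot h) (hQ t t' ht ht' hroot h)

theorem ignoresChildren_isChild (hx : u ≠ x) (hy : u ≠ y) (hz : u ≠ z) :
    IgnoresChildren (IsChild u v) x y z :=
  fun _ _ _ _ _ h => h u v hx hy hz

theorem ignoresChildren_isLeaf (hx : u ≠ x) (hy : u ≠ y) (hz : u ≠ z) :
    IgnoresChildren (IsLeaf u) x y z :=
  fun _ _ _ _ _ h => forall_congr' fun v => not_congr (h u v hx hy hz)

theorem ignoresChildren_inMinChain (hx : u ≤ x) (hy : u ≤ y) (hz : u ≤ z) :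
    IgnoresChildren (fun t => InMinChain t u) x y z := by
  intro t t' ht ht' hroot h
  refine inMinChain_congr ht ht' (fun a _ => by rw [hroot]) fun a b hb => ?_
  by_cases hab : a < b
  · exact h a b (by omega) (by omega) (by omega)
  · exact iff_of_false (mt ht.lt hab) (mt ht'.lt hab)

end IgnoresChildren

theorem canInsert_sdiff {F : Finset ℕ} {c x y z : ℕ} (hx : x ∈ F) (hy : y ∈ F) (hz : z ∈ F)
    (hyz : y ≠ z) (hxc : x < c) (hcy : c ≤ y) (hcz : c ≤ z)
    (hleft : ∀ b ∈ F, c ≤ b → b ≠ y → b ≠ z → y < b) :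
    CanInsert (F \ {y, z}) F c x y z where
  val_eq := by
    rw [← Finset.insert_val_of_notMem (by simp), ← Finset.insert_val_of_notMem (by simp [hyz])]
    congr 1
    ext a
    simp only [Finset.mem_insert, Finset.mem_sdiff, Finset.mem_singleton]
    grind
  mem := by simp only [Finset.mem_sdiff, Finset.mem_insert, Finset.mem_singleton]; grind
  lt_cutoff := hxc
  cutoff_le_left := hcy
  cutoff_le_right := hcz
  left_lt b hb hcb := by
    simp only [Finset.mem_sdiff, Finset.mem_insert, Finset.mem_singleton, not_or] at hb
    exact hleft b hb.1 hcb hb.2.1 hb.2.2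

section Fibre

variable {S F : Finset ℕ} {c x y z : ℕ} {P : BinaryTree ℕ → Prop} {i : Insertion}
  {t : BinaryTree ℕ}

theorem isChild_iff_root?_subtreesAt (ht : (labels t).Nodup) (hx : x ∈ labels t) {b : ℕ} :
    IsChild x b t ↔ root? (subtreesAt x t).1 = some b ∨ root? (subtreesAt x t).2 = some b :=
  isChild_iff_of_isSubtree ht (isSubtree_subtreesAt hx)

theorem LabelsIncrease.subtreesAt (ht : LabelsIncrease t) (hx : x ∈ labels t) :
    LabelsIncrease (node x (subtreesAt x t).1 (subtreesAt x t).2) :=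
  ht.of_isSubtree (isSubtree_subtreesAt hx)

/-- The result of an insertion below the node `x` of `t`. -/
def insertAt (i : Insertion) (x y z : ℕ) (t : BinaryTree ℕ) : BinaryTree ℕ :=
  replaceAt x (i.apply y z (subtreesAt x t)) t

theorem subtreesAt_insertAt (hx : x ∈ labels t) :
    subtreesAt x (insertAt i x y z t) = i.apply y z (subtreesAt x t) :=
  subtreesAt_replaceAt hx

theorem replaceAt_insertAt (hx : x ∈ labels t) :
    replaceAt x (subtreesAt x t) (insertAt i x y z t) = t := by
  rw [insertAt, replaceAt_replaceAt hx, replaceAt_subtreesAt hx]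

theorem labels_insertAt (hx : x ∈ labels t) :
    labels (insertAt i x y z t) = y ::ₘ z ::ₘ labels t := by
  have h := labels_replaceAt hx (p := i.apply y z (subtreesAt x t))
  rw [Insertion.labels_apply, Multiset.add_cons, Multiset.add_cons, ← Multiset.cons_add,
    ← Multiset.cons_add] at h
  exact add_right_cancel h

theorem labels_insertAt_iff (h : CanInsert S F c x y z) (hx : x ∈ labels t) :
    labels (insertAt i x y z t) = F.val ↔ labels t = S.val := by
  rw [labels_insertAt hx, h.val_eq, Multiset.cons_inj_right, Multiset.cons_inj_right]

theorem isComplete_insertAt_iff (hx : x ∈ labels t) :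
    IsComplete (insertAt i x y z t) ↔ IsComplete t ∧
      IsComplete (node x (i.apply y z (subtreesAt x t)).1 (i.apply y z (subtreesAt x t)).2) := by
  have hx' : x ∈ labels (insertAt i x y z t) := mem_labels_replaceAt hx
  constructor
  · intro ht
    have hsub := ht.of_isSubtree (isSubtree_subtreesAt hx')
    rw [subtreesAt_insertAt hx] at hsub
    refine ⟨?_, hsub⟩
    rw [← replaceAt_insertAt (i := i) (y := y) (z := z) hx]
    refine ht.replaceAt hx' (Insertion.isComplete_of_apply hsub) ?_
    rw [subtreesAt_insertAt hx, Insertion.even_numNodes_apply_iff]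
  · rintro ⟨ht, hp⟩
    exact ht.replaceAt hx hp Insertion.even_numNodes_apply_iff.symm

theorem labelsIncrease_insertAt_iff (h : CanInsert S F c x y z)
    (hi : (∃ zRight, i = .push zRight) ∨ y < z) (ht : labels t = S.val) :
    (LabelsIncrease (insertAt i x y z t) ∧ ChildrenGe c x (insertAt i x y z t)) ↔
      LabelsIncrease t ∧ ChildrenGe c x t := by
  have hx : x ∈ labels t := ht ▸ h.mem
  have hx' : x ∈ labels (insertAt i x y z t) := mem_labels_replaceAt hx
  have hchild {b : ℕ} := isChild_iff_root?_subtreesAt (b := b) (ht ▸ S.nodup) hx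
  have hchild' {b : ℕ} := isChild_iff_root?_subtreesAt (b := b)
    ((labels_insertAt_iff (i := i) h hx).2 ht ▸ F.nodup) hx'
  have hlt (b : ℕ) (hb : root? (subtreesAt x t).1 = some b ∨ root? (subtreesAt x t).2 = some b)
      (hcb : c ≤ b) : y < b := by
    have hbt := (hchild.2 hb).mem_right
    rw [ht] at hbt
    exact h.left_lt b hbt hcb
  have hiff := Insertion.labelsIncrease_apply_iff h.lt_cutoff h.cutoff_le_left h.cutoff_le_right
    hi hlt
  simp only [ChildrenGe, hchild, hchild', subtreesAt_insertAt hx]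
  constructor
  · rintro ⟨hinc, hge⟩
    have hsub := hinc.subtreesAt hx'
    rw [subtreesAt_insertAt hx] at hsub
    obtain ⟨hp, hpge⟩ := hiff.1 ⟨hsub, hge⟩
    refine ⟨?_, hpge⟩
    rw [← replaceAt_insertAt (i := i) (y := y) (z := z) hx]
    exact hinc.replaceAt hx' hp
  · rintro ⟨hinc, hge⟩
    obtain ⟨hp, hpge⟩ := hiff.2 ⟨hinc.subtreesAt hx, hge⟩
    exact ⟨hinc.replaceAt hx hp, hpge⟩

theorem insertAt_mem_iff (h : CanInsert S F c x y z)
    (hi : (∃ zRight, i = .push zRight) ∨ y < z) (hP : IgnoresChildren P x y z)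
    (hx : x ∈ labels t) :
    (insertAt i x y z t ∈ completeTreesOn F ∧ P (insertAt i x y z t) ∧
      ChildrenGe c x (insertAt i x y z t)) ↔
    t ∈ completeTreesOn S ∧ P t ∧ ChildrenGe c x t ∧
      IsComplete (node x (i.apply y z (subtreesAt x t)).1 (i.apply y z (subtreesAt x t)).2) := by
  have hP' (hinc' : LabelsIncrease (insertAt i x y z t)) (hinc : LabelsIncrease t) :
      P (insertAt i x y z t) ↔ P t :=
    hP _ _ hinc' hinc root?_replaceAt fun a b hax hay haz =>
      isChild_replaceAt hax hx (Insertion.isChild_apply_iff hay haz)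
  simp only [completeTreesOn, Set.mem_ofPred_eq, labels_insertAt_iff h hx,
    isComplete_insertAt_iff hx]
  by_cases ht : labels t = S.val
  · have := labelsIncrease_insertAt_iff h hi ht
    tauto
  · tauto

theorem count_subtreesAt_eq_apply (h : CanInsert S F c x y z)
    (hi : (∃ zRight, i = .push zRight) ∨ y < z) (hP : IgnoresChildren P x y z) :
    count F (fun t => (P t ∧ ChildrenGe c x t) ∧ ∃ p, subtreesAt x t = i.apply y z p) =
      count S (fun t => (P t ∧ ChildrenGe c x t) ∧
        IsComplete (node x (i.apply y z (subtreesAt x t)).1 (i.apply y z (subtreesAt x t)).2)) := by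
  unfold count
  congr 1
  symm
  refine Set.ncard_congr (fun t _ => insertAt i x y z t) ?_ ?_ ?_
  · rintro t ⟨ht, ⟨hPt, hge⟩, hcomplete⟩
    have hx := (mem_labels_of_mem_completeTreesOn ht).2 h.mem
    obtain ⟨ht', hP', hge'⟩ := (insertAt_mem_iff h hi hP hx).2 ⟨ht, hPt, hge, hcomplete⟩
    exact ⟨ht', ⟨hP', hge'⟩, _, subtreesAt_insertAt hx⟩
  · rintro s t ⟨hs, -⟩ ⟨ht, -⟩ hst
    have hxs := (mem_labels_of_mem_completeTreesOn hs).2 h.mem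
    have hxt := (mem_labels_of_mem_completeTreesOn ht).2 h.mem
    have hsub := congrArg (subtreesAt x) hst
    rw [subtreesAt_insertAt hxs, subtreesAt_insertAt hxt] at hsub
    rw [← replaceAt_insertAt (i := i) (y := y) (z := z) hxs, hst,
      i.apply_injective y z hsub, replaceAt_insertAt hxt]
  · rintro t' ⟨ht', ⟨hPt', hge'⟩, p, hp⟩
    have hx' := h.mem_labels ht'
    have hx : x ∈ labels (replaceAt x p t') := mem_labels_replaceAt hx'
    have hinsert : insertAt i x y z (replaceAt x p t') = t' := by
      rw [insertAt, subtreesAt_replaceAt hx', ← hp, replaceAt_replaceAt hx',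
        replaceAt_subtreesAt hx']
    obtain ⟨ht, hPt, hge, hcomplete⟩ := (insertAt_mem_iff h hi hP hx).1 <| by
      rw [hinsert]
      exact ⟨ht', hPt', hge'⟩
    exact ⟨_, ⟨ht, ⟨hPt, hge⟩, hcomplete⟩, hinsert⟩

end Fibre

section GrowthsAndPushes

variable {S F : Finset ℕ} {c x y z : ℕ} {P : BinaryTree ℕ → Prop} {t : BinaryTree ℕ}

theorem IsLeaf.eq_node {s : BinaryTree ℕ} (hz : IsLeaf z t) (ht : (labels t).Nodup)
    (hs : IsSubtree s t) (hroot : root? s = some z) : s = node z nil nil := by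
  obtain ⟨l, r, rfl⟩ := eq_node_of_root? hroot
  obtain ⟨rfl, rfl⟩ := (isLeaf_iff_of_isSubtree ht hs).1 hz
  rfl

theorem isChild_isLeaf_of_subtreesAt_eq_apply {i : Insertion} {p : BinaryTree ℕ × BinaryTree ℕ}
    (ht : (labels t).Nodup) (hx : x ∈ labels t) (h : subtreesAt x t = i.apply y z p) :
    IsChild x y t ∧ IsLeaf z t := by
  have hsub := isSubtree_subtreesAt hx
  rw [h] at hsub
  have hchild : IsChild x y (node x (i.apply y z p).1 (i.apply y z p).2) := by
    rcases i with ⟨_ | _, _ | _⟩ | ⟨_ | _⟩ <;> simp [Insertion.apply, isChild_node, root?]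
  have hleaf : IsSubtree (node z nil nil) (node x (i.apply y z p).1 (i.apply y z p).2) := by
    rcases i with ⟨_ | _, _ | _⟩ | ⟨_ | _⟩ <;> simp [Insertion.apply, IsSubtree]
  exact ⟨hchild.of_isSubtree hsub, (isLeaf_iff_of_isSubtree ht (hleaf.trans hsub)).2 ⟨rfl, rfl⟩⟩

theorem exists_subtreesAt_eq_growth_iff (ht : (labels t).Nodup) (hx : x ∈ labels t) :
    (∃ i : Bool × Bool, ∃ p, subtreesAt x t = (Insertion.growth i.1 i.2).apply y z p) ↔
      IsChild x y t ∧ IsChild y z t ∧ IsLeaf z t := by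
  have hsub := isSubtree_subtreesAt hx
  constructor
  · rintro ⟨⟨yRight, zRight⟩, p, h⟩
    obtain ⟨hxy, hz⟩ := isChild_isLeaf_of_subtreesAt_eq_apply ht hx h
    rw [h] at hsub
    refine ⟨hxy, IsChild.of_isSubtree ?_ hsub, hz⟩
    cases yRight <;> cases zRight <;> simp [Insertion.apply, isChild_node, root?]
  · rintro ⟨hxy, hyz, hz⟩
    have hnode (s : BinaryTree ℕ) (hs : IsSubtree s t) (hroot : root? s = some y) :
        ∃ q, s = node y (node z nil nil) q ∨ s = node y q (node z nil nil) := by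
      obtain ⟨l, r, rfl⟩ := eq_node_of_root? hroot
      obtain h | h := (isChild_iff_of_isSubtree ht hs).1 hyz
      · exact ⟨r, .inl (by rw [hz.eq_node ht ((IsSubtree.left ..).trans hs) h])⟩
      · exact ⟨l, .inr (by rw [hz.eq_node ht ((IsSubtree.right ..).trans hs) h])⟩
    obtain h | h := (isChild_iff_of_isSubtree ht hsub).1 hxy
    · obtain ⟨q, hq | hq⟩ := hnode _ ((IsSubtree.left ..).trans hsub) h
      exacts [⟨(false, false), (q, _), Prod.ext hq rfl⟩, ⟨(false, true), (q, _), Prod.ext hq rfl⟩]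
    · obtain ⟨q, hq | hq⟩ := hnode _ ((IsSubtree.right ..).trans hsub) h
      exacts [⟨(true, false), (_, q), Prod.ext rfl hq⟩, ⟨(true, true), (_, q), Prod.ext rfl hq⟩]

theorem exists_subtreesAt_eq_push_iff (ht : (labels t).Nodup) (hx : x ∈ labels t) (hyz : y ≠ z) :
    (∃ zRight, ∃ p, subtreesAt x t = (Insertion.push zRight).apply y z p) ↔
      IsChild x y t ∧ IsChild x z t ∧ IsLeaf z t := by
  have hsub := isSubtree_subtreesAt hx
  constructor
  · rintro ⟨zRight, p, h⟩
    obtain ⟨hxy, hz⟩ := isChild_isLeaf_of_subtreesAt_eq_apply ht hx h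
    rw [h] at hsub
    refine ⟨hxy, IsChild.of_isSubtree ?_ hsub, hz⟩
    cases zRight <;> simp [Insertion.apply, isChild_node, root?]
  · rintro ⟨hxy, hxz, hz⟩
    rw [isChild_iff_of_isSubtree ht hsub] at hxy hxz
    obtain h | h := hxz
    · obtain ⟨l, r, hlr⟩ := eq_node_of_root? (hxy.resolve_left (by simp [h, hyz.symm]))
      exact ⟨false, (l, r), Prod.ext (hz.eq_node ht ((IsSubtree.left ..).trans hsub) h) hlr⟩
    · obtain ⟨l, r, hlr⟩ := eq_node_of_root? (hxy.resolve_right (by simp [h, hyz.symm]))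
      exact ⟨true, (l, r), Prod.ext hlr (hz.eq_node ht ((IsSubtree.right ..).trans hsub) h)⟩

theorem count_exists_subtreesAt_eq_apply {ι : Type*} [Fintype ι] {g : ι → Insertion}
    (hg : g.Injective) (h : CanInsert S F c x y z)
    (hi : ∀ i, (∃ zRight, g i = .push zRight) ∨ y < z) (hP : IgnoresChildren P x y z) :
    count F (fun t => (P t ∧ ChildrenGe c x t) ∧
      ∃ i, ∃ p, subtreesAt x t = (g i).apply y z p) =
    ∑ i, count S (fun t => (P t ∧ ChildrenGe c x t) ∧
      IsComplete (node x ((g i).apply y z (subtreesAt x t)).1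
        ((g i).apply y z (subtreesAt x t)).2)) := by
  simp only [← count_subtreesAt_eq_apply h (hi _) hP]
  rw [← count_exists_eq_sum]
  · simp only [Finset.mem_univ, true_and]
  · rintro t ht i - j - ⟨p, hp⟩ ⟨q, hq⟩
    refine hg (Insertion.eq_of_apply_eq (hp.symm.trans hq) ?_)
    have hle := (isSubtree_subtreesAt (h.mem_labels ht)).labels_le
    rw [labels, hp, Insertion.labels_apply] at hle
    exact Multiset.nodup_of_le ((Multiset.le_cons_self _ _).trans hle)
      (nodup_of_mem_completeTreesOn ht)

theorem count_growth (h : CanInsert S F c x y z) (hyz : y < z) (hP : IgnoresChildren P x y z) :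
    count F (fun t => (P t ∧ ChildrenGe c x t) ∧
      IsChild x y t ∧ IsChild y z t ∧ IsLeaf z t) =
    3 * count S (fun t => (P t ∧ ChildrenGe c x t) ∧ Odd (subtreesAt x t).1.numNodes) +
      count S (fun t => (P t ∧ ChildrenGe c x t) ∧ Odd (subtreesAt x t).1.numNodes ∧
        Odd (subtreesAt x t).2.numNodes) := by
  have hsum := count_exists_subtreesAt_eq_apply (g := fun i : Bool × Bool => .growth i.1 i.2)
    (fun i j hij => by simpa [Prod.ext_iff] using hij) h (fun _ => .inr hyz) hP
  have hiff (yRight zRight : Bool) (t : BinaryTree ℕ) (ht : t ∈ completeTreesOn S) :=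
    Insertion.isComplete_growth_iff (x := x) (y := y) (z := z) (p := subtreesAt x t)
      (yRight := yRight) (zRight := zRight) |>.trans
      (and_iff_right (ht.2.2.of_isSubtree (isSubtree_subtreesAt (ht.1 ▸ h.mem))))
  rw [count_congr fun t ht => and_congr_right' (exists_subtreesAt_eq_growth_iff
    (nodup_of_mem_completeTreesOn ht) (h.mem_labels ht)).symm, hsum, Fintype.sum_prod_type]
  simp only [Fintype.sum_bool]
  simp only [count_congr fun t ht => and_congr_right' (hiff _ _ t ht)]
  simp only [Bool.false_eq_true, and_false, false_imp_iff, and_true, true_imp_iff]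
  ring

theorem count_push (h : CanInsert S F c x y z) (hP : IgnoresChildren P x y z) :
    count F (fun t => (P t ∧ ChildrenGe c x t) ∧
      IsChild x y t ∧ IsChild x z t ∧ IsLeaf z t) =
    count S (fun t => P t ∧ ChildrenGe c x t) +
      count S (fun t => (P t ∧ ChildrenGe c x t) ∧ (Odd (subtreesAt x t).1.numNodes →
        Odd (subtreesAt x t).2.numNodes)) := by
  have hsum := count_exists_subtreesAt_eq_apply (g := .push)
    (fun i j hij => by simpa using hij) h (fun _ => .inl ⟨_, rfl⟩) hP
  have hiff (zRight : Bool) (t : BinaryTree ℕ) (ht : t ∈ completeTreesOn S) :=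
    Insertion.isComplete_push_iff (x := x) (y := y) (z := z) (p := subtreesAt x t)
      (zRight := zRight) |>.trans
      (and_iff_right (ht.2.2.of_isSubtree (isSubtree_subtreesAt (ht.1 ▸ h.mem))))
  rw [count_congr fun t ht => and_congr_right' (exists_subtreesAt_eq_push_iff
    (nodup_of_mem_completeTreesOn ht) (h.mem_labels ht) h.ne).symm, hsum]
  simp only [Fintype.sum_bool, count_congr fun t ht => and_congr_right' (hiff _ t ht)]
  simp only [Bool.false_eq_true, false_imp_iff, and_true, true_imp_iff]
  ring

theorem isLeaf_iff_not_odd_subtreesAt (ht : t ∈ completeTreesOn S) (hx : x ∈ labels t) :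
    IsLeaf x t ↔ ¬ Odd (subtreesAt x t).1.numNodes := by
  have hsub := isSubtree_subtreesAt hx
  have hcomplete := (ht.2.2.of_isSubtree hsub).1
  rw [isLeaf_iff_of_isSubtree (nodup_of_mem_completeTreesOn ht) hsub]
  constructor
  · rintro ⟨hl, -⟩
    simp [hl]
  · exact hcomplete.resolve_left

theorem count_growth_sub_count_push {y' z' : ℕ} (h : CanInsert S F c x y z)
    (h' : CanInsert S F c x y' z') (hyz : y < z) (hP : IgnoresChildren P x y z)
    (hP' : IgnoresChildren P x y' z') :
    count F (fun t => (P t ∧ ChildrenGe c x t) ∧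
        IsChild x y t ∧ IsChild y z t ∧ IsLeaf z t) -
      count F (fun t => (P t ∧ ChildrenGe c x t) ∧
        IsChild x y' t ∧ IsChild x z' t ∧ IsLeaf z' t) =
    2 * count S (fun t => P t ∧ ChildrenGe c x t) -
      4 * count S (fun t => (P t ∧ ChildrenGe c x t) ∧ IsLeaf x t) := by
  rw [count_growth h hyz hP, count_push h' hP', count_imp_eq_add, count_congr fun t ht =>
    and_congr_right' (isLeaf_iff_not_odd_subtreesAt ht (ht.1 ▸ h.mem))]
  have hbase := count_eq_add (S := S) (fun t => P t ∧ ChildrenGe c x t)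
    fun t => Odd (subtreesAt x t).1.numNodes
  linarith

end GrowthsAndPushes

/-! ### Exchanging consecutive labels -/

theorem labelsIncrease_map_swap_iff {k : ℕ} {t : BinaryTree ℕ} :
    (LabelsIncrease (t.map (Equiv.swap k (k + 1))) ∧
      ¬ IsChild k (k + 1) (t.map (Equiv.swap k (k + 1)))) ↔
      LabelsIncrease t ∧ ¬ IsChild k (k + 1) t := by
  have hswap : IsChild k (k + 1) (t.map (Equiv.swap k (k + 1))) ↔ IsChild (k + 1) k t := by
    simpa using isChild_map_apply_iff (t := t) (Equiv.swap k (k + 1)).injective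
      (a := k + 1) (b := k)
  rw [hswap, labelsIncrease_map_iff_forall, labelsIncrease_iff]
  simp only [Equiv.swap_apply_def]
  grind

/-- Exchanging the labels `k` and `k + 1` destroys monotonicity only if they are adjacent. -/
theorem count_swap {S : Finset ℕ} {k : ℕ} (hS : k ∈ S ↔ k + 1 ∈ S) {P P' : BinaryTree ℕ → Prop}
    (h : ∀ t, labels t = S.val → LabelsIncrease t →
      LabelsIncrease (t.map (Equiv.swap k (k + 1))) →
      (P t ↔ P' (t.map (Equiv.swap k (k + 1))))) :
    count S (fun t => P t ∧ ¬ IsChild k (k + 1) t) =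
      count S (fun t => P' t ∧ ¬ IsChild k (k + 1) t) := by
  refine count_relabel (Equiv.swap k (k + 1)).injective ?_ fun t ht => ?_
  · ext a
    simp only [Finset.mem_image, Equiv.swap_apply_def]
    grind
  · have := @labelsIncrease_map_swap_iff k t
    have := h t ht
    tauto

/-! ### The equation in the second variable -/

theorem isLeaf_of_labels_eq_Icc {N : ℕ} {t : BinaryTree ℕ} (hinc : LabelsIncrease t)
    (ht : labels t = (Finset.Icc 1 N).val) : IsLeaf N t := by
  intro b hb
  have hmem := hb.mem_right
  rw [ht, Finset.mem_val, Finset.mem_Icc] at hmem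
  exact (hinc.lt hb).not_ge hmem.2

section DiffK

variable {m k N : ℕ}

theorem eoc_map_swap_eq_iff {S : Finset ℕ} {t : BinaryTree ℕ} (hmk : m < k) (hkS : k ∈ S)
    (ht : labels t = S.val) (hinc : LabelsIncrease t)
    (hinc' : LabelsIncrease (t.map (Equiv.swap k (k + 1)))) :
    eoc (t.map (Equiv.swap k (k + 1))) = m ↔ eoc t = m :=
  eoc_map_eq_iff (Equiv.injective _) (ht ▸ S.nodup) (ne_nil_of_labels_eq_val ⟨k, hkS⟩ ht) hinc
    hinc'
    (fun b hb => Equiv.swap_apply_of_ne_of_ne (by omega) (by omega))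
    (fun b hb => by rw [Equiv.swap_apply_def]; grind)

theorem count_eoc_isChild_sub (hmk : m < k) (hkN : k + 1 < N) :
    count (Finset.Icc 1 N) (fun t => (eoc t = m ∧ IsChild (k + 1) N t) ∧ IsChild k (k + 1) t) -
      count (Finset.Icc 1 N) (fun t => (eoc t = m ∧ IsChild k N t) ∧ IsChild k (k + 1) t) =
    2 * count (Finset.Icc 1 N \ {k + 1, N}) (fun t => eoc t = m) -
      4 * count (Finset.Icc 1 N \ {k + 1, N}) (fun t => eoc t = m ∧ IsLeaf k t) := by
  have hins : CanInsert (Finset.Icc 1 N \ {k + 1, N}) (Finset.Icc 1 N) (k + 1) k (k + 1) N :=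
    canInsert_sdiff (by grind) (by grind) (by grind) (by omega) (by omega)
      le_rfl hkN.le (by omega)
  have hignores : IgnoresChildren (fun t => InMinChain t m ∧ IsLeaf m t) k (k + 1) N :=
    (ignoresChildren_inMinChain (by omega) (by omega) (by omega)).and
      (ignoresChildren_isLeaf (by omega) (by omega) (by omega))
  have heoc {S : Finset ℕ} (hS : k ∈ S) {t : BinaryTree ℕ} (ht : t ∈ completeTreesOn S) :
      eoc t = m ↔ (InMinChain t m ∧ IsLeaf m t) ∧ ChildrenGe (k + 1) k t := by
    rw [eoc_eq_iff (nodup_of_mem_completeTreesOn ht) (ne_nil_of_labels_eq_val ⟨k, hS⟩ ht.1)]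
    exact (and_iff_left fun b hb => ht.2.1.lt hb).symm
  rw [count_congr fun t => heoc hins.mem,
    count_congr fun t ht => and_congr_left' (c := IsLeaf k t) (heoc hins.mem ht),
    ← count_growth_sub_count_push hins hins (by omega) hignores hignores]
  congr 1 <;> refine count_congr fun t ht => ?_ <;>
  · rw [← heoc (by grind) ht]
    have := isLeaf_of_labels_eq_Icc ht.2.1 ht.1
    tauto

theorem count_eoc_relabel (hmk : m < k) (hkN : k + 1 < N) {Q Q' : BinaryTree ℕ → Prop}
    (hQ : ∀ t : BinaryTree ℕ, Q t ↔ Q' (t.map fun b => if b ≤ k then b else b + 1)) :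
    count (Finset.Icc 1 N \ {k + 1, N}) (fun t => eoc t = m ∧ Q' t) =
      count (Finset.Icc 1 (N - 2)) (fun t => eoc t = m ∧ Q t) := by
  set σ : ℕ → ℕ := fun b => if b ≤ k then b else b + 1 with hσ_def
  have hσ : StrictMono σ := by intro a b hab; grind
  have hσS : (Finset.Icc 1 (N - 2)).image σ = Finset.Icc 1 N \ {k + 1, N} := by
    ext a
    simp only [Finset.mem_image, Finset.mem_Icc, Finset.mem_sdiff, Finset.mem_insert,
      Finset.mem_singleton, hσ_def]
    exact ⟨by grind, fun ha => ⟨if a ≤ k then a else a - 1, by grind⟩⟩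
  refine (count_relabel_strictMono hσ hσS fun t ht hinc => ?_).symm
  rw [hQ t, eoc_map_eq_iff hσ.injective (ht ▸ Finset.nodup _)
    (ne_nil_of_labels_eq_val ⟨k, by grind⟩ ht) hinc ((labelsIncrease_map_iff hσ).2 hinc)
    (by grind) (by grind)]

theorem diffK_f (hmk : m < k) (hkN : k + 1 < N) :
    diffK (f N) m k = 2 * count (Finset.Icc 1 (N - 2)) (fun t => eoc t = m) -
      4 * count (Finset.Icc 1 (N - 2)) (fun t => eoc t = m ∧ IsLeaf k t) := by
  have hswap : count (Finset.Icc 1 N)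
        (fun t => (eoc t = m ∧ IsChild (k + 1) N t) ∧ ¬ IsChild k (k + 1) t) =
      count (Finset.Icc 1 N) (fun t => (eoc t = m ∧ IsChild k N t) ∧ ¬ IsChild k (k + 1) t) := by
    refine count_swap (by simp only [Finset.mem_Icc]; omega) fun t ht hinc hinc' => ?_
    have hchild := isChild_map_apply_iff (t := t) (Equiv.swap k (k + 1)).injective
      (a := k + 1) (b := N)
    rw [Equiv.swap_apply_right, Equiv.swap_apply_of_ne_of_ne (by omega) (by omega)] at hchild
    rw [eoc_map_swap_eq_iff hmk (by grind) ht hinc hinc', hchild]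
  have hbase := count_eoc_relabel hmk hkN (Q := fun _ => True) (Q' := fun _ => True)
    fun _ => Iff.rfl
  have hleaf := count_eoc_relabel hmk hkN (Q := IsLeaf k) (Q' := IsLeaf k) fun t => by
    simpa using
      (isLeaf_map_apply_iff (t := t) (σ := fun b => if b ≤ k then b else b + 1)
        (fun a b hab => by grind) (a := k)).symm
  simp only [and_true] at hbase
  rw [diffK, f_eq_count (by omega) (by omega), f_eq_count (by omega) (by omega),
    count_eq_add _ (IsChild k (k + 1)), count_eq_add (fun t => eoc t = m ∧ IsChild k N t)
      (IsChild k (k + 1)), hswap, ← hbase, ← hleaf, ← count_eoc_isChild_sub hmk hkN]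
  ring

/-- Moving the leaf label `k + 1` to the top of the label range. -/
theorem count_eoc_isLeaf_isChild {M : ℕ} (hmk : m < k) (hkM : k < M) :
    count (Finset.Icc 1 M) (fun t => (eoc t = m ∧ IsLeaf (k + 1) t) ∧ IsChild k (k + 1) t) =
      f M m k := by
  rw [f_eq_count (by omega) (by omega)]
  set σ : ℕ → ℕ := fun b => if b = k + 1 then M else if k + 1 < b ∧ b ≤ M then b - 1 else b
    with hσ_def
  have hσ : σ.Injective := by intro a b hab; grind
  have hσS : (Finset.Icc 1 M).image σ = Finset.Icc 1 M := by
    ext a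
    simp only [Finset.mem_image, Finset.mem_Icc, hσ_def]
    refine ⟨by grind, fun ha => ⟨if a = M then k + 1 else if k < a then a + 1 else a, by grind⟩⟩
  refine count_relabel hσ hσS fun t ht => ?_
  have hmem {a b : ℕ} (hab : IsChild a b t) : a ≤ M ∧ b ≤ M := by
    have ha := hab.mem_left
    have hb := hab.mem_right
    rw [ht, Finset.mem_val, Finset.mem_Icc] at ha hb
    exact ⟨ha.2, hb.2⟩
  have hchild := isChild_map_apply_iff (t := t) hσ (a := k) (b := k + 1)
  rw [show σ k = k by grind, show σ (k + 1) = M by grind] at hchild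
  rw [hchild]
  have hinc (hk : IsChild k (k + 1) t) :
      LabelsIncrease (t.map σ) ↔ LabelsIncrease t ∧ IsLeaf (k + 1) t := by
    have hparent {a : ℕ} (ha : IsChild a (k + 1) t) : a = k :=
      ha.parent_unique (ht ▸ Finset.nodup _) hk
    rw [labelsIncrease_map_iff_forall, labelsIncrease_iff]
    refine ⟨fun h => ?_, fun ⟨h, hleaf⟩ a b hab => ?_⟩
    · have hleaf : IsLeaf (k + 1) t := fun b hb => by grind
      have hlt {a b : ℕ} (hab : IsChild a b t) : a < b := by
        have := h a b hab
        grind [IsLeaf]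
      exact ⟨fun a b => hlt, hleaf⟩
    · have hak : a ≠ k + 1 := fun hak => hleaf b (hak ▸ hab)
      have hlt := h a b hab
      grind
  have heoc (h : LabelsIncrease t) (h' : LabelsIncrease (t.map σ)) :
      eoc (t.map σ) = m ↔ eoc t = m :=
    eoc_map_eq_iff hσ (ht ▸ Finset.nodup _)
      (ne_nil_of_labels_eq_val ⟨M, by grind⟩ ht) h h' (by grind) (by grind)
  tauto

theorem count_eoc_isLeaf_sub {M : ℕ} (hmk : m < k) (hkM : k < M) :
    count (Finset.Icc 1 M) (fun t => eoc t = m ∧ IsLeaf (k + 1) t) -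
      count (Finset.Icc 1 M) (fun t => eoc t = m ∧ IsLeaf k t) = f M m k := by
  have hnone : count (Finset.Icc 1 M)
      (fun t => (eoc t = m ∧ IsLeaf k t) ∧ ¬ IsChild k (k + 1) t) =
        count (Finset.Icc 1 M) (fun t => eoc t = m ∧ IsLeaf k t) :=
    count_congr fun t _ => ⟨And.left, fun h => ⟨h, h.2 _⟩⟩
  have hswap : count (Finset.Icc 1 M)
        (fun t => (eoc t = m ∧ IsLeaf (k + 1) t) ∧ ¬ IsChild k (k + 1) t) =
      count (Finset.Icc 1 M) (fun t => (eoc t = m ∧ IsLeaf k t) ∧ ¬ IsChild k (k + 1) t) := by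
    refine count_swap (by simp only [Finset.mem_Icc]; omega) fun t ht hinc hinc' => ?_
    have hleaf := isLeaf_map_apply_iff (t := t) (Equiv.swap k (k + 1)).injective (a := k + 1)
    rw [Equiv.swap_apply_right] at hleaf
    rw [eoc_map_swap_eq_iff hmk (by grind) ht hinc hinc', hleaf]
  rw [count_eq_add _ (IsChild k (k + 1)), count_eoc_isLeaf_isChild hmk hkM, hswap, hnone]
  ring

theorem diffK_diffK_f (hmk : m < k) (hkN : k + 3 ≤ N) :
    diffK (diffK (f N)) m k + 4 * f (N - 2) m k = 0 := by
  rw [diffK, diffK_f (by omega) (by omega), diffK_f hmk (by omega),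
    ← count_eoc_isLeaf_sub hmk (by omega)]
  ring

end DiffK

/-! ### The equation in the first variable -/

/-- The labels `a` and `b` have the same parent in `t`. -/
def AreSiblings (a b : ℕ) (t : BinaryTree ℕ) : Prop :=
  ∃ p, IsChild p a t ∧ IsChild p b t

theorem InMinChain.not_areSiblings {t : BinaryTree ℕ} (ht : (labels t).Nodup) {a b : ℕ}
    (hb : InMinChain t b) (hab : a < b) : ¬ AreSiblings a b t := by
  rintro ⟨p, hpa, hpb⟩
  obtain hroot | ⟨q, -, hqb⟩ := hb.root_or_isMinChild
  · exact not_isChild_root ht hroot hpb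
  · obtain rfl := hqb.1.parent_unique ht hpb
    exact (hqb.2 a hpa).not_gt hab

theorem InMinChain.iff_exists_isLastBelow {t : BinaryTree ℕ} (ht : LabelsIncrease t) {m : ℕ}
    (hroot : root? t ≠ some m) :
    InMinChain t m ↔ ∃ x, IsLastBelow m x t ∧ IsChild x m t := by
  constructor
  · intro hm
    obtain h | ⟨x, hx, hxm⟩ := hm.root_or_isMinChild
    · exact absurd h hroot
    · exact ⟨x, ⟨hx, ht.lt hxm.1, hxm.2⟩, hxm.1⟩
  · rintro ⟨x, hx, hxm⟩
    exact hx.1.tail ⟨hxm, hx.2.2⟩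

section DiffM

variable {m k N : ℕ}

theorem eoc_map_swap {t : BinaryTree ℕ} (hnodup : (labels t).Nodup) (hnil : t ≠ nil)
    (ht : LabelsIncrease t) (hsib : ¬ AreSiblings m (m + 1) t) :
    eoc (t.map (Equiv.swap m (m + 1))) = Equiv.swap m (m + 1) (eoc t) := by
  refine eoc_map (Equiv.injective _) hnodup hnil ht fun p b c hb hc _ hbc => ?_
  have hne : ¬ (b = m ∧ c = m + 1) := by
    rintro ⟨rfl, rfl⟩
    exact hsib ⟨p, hb, hc⟩
  simp only [Equiv.swap_apply_def]
  grind

theorem areSiblings_map_swap {t : BinaryTree ℕ} :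
    AreSiblings m (m + 1) (t.map (Equiv.swap m (m + 1))) ↔ AreSiblings m (m + 1) t := by
  have hchild (p b : ℕ) : IsChild p (Equiv.swap m (m + 1) b) (t.map (Equiv.swap m (m + 1))) ↔
      IsChild (Equiv.swap m (m + 1) p) b t := by
    simpa using isChild_map_apply_iff (t := t) (Equiv.swap m (m + 1)).injective
      (a := Equiv.swap m (m + 1) p) (b := b)
  have hm := fun p => hchild p (m + 1)
  have hm' := fun p => hchild p m
  simp only [Equiv.swap_apply_left, Equiv.swap_apply_right] at hm hm'
  simp only [AreSiblings, hm, hm']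
  rw [← (Equiv.swap m (m + 1)).surjective.exists
    (p := fun p => IsChild p (m + 1) t ∧ IsChild p m t)]
  exact exists_congr fun p => and_comm

theorem count_eoc_succ_not_isChild (hm : 1 ≤ m) (hmk : m + 1 < k) (hkN : k < N) :
    count (Finset.Icc 1 N) (fun t => (eoc t = m + 1 ∧ IsChild k N t) ∧ ¬ IsChild m (m + 1) t) =
      count (Finset.Icc 1 N)
        (fun t => (eoc t = m ∧ IsChild k N t) ∧ ¬ AreSiblings m (m + 1) t) := by
  have hnil {t : BinaryTree ℕ} (ht : labels t = (Finset.Icc 1 N).val) : t ≠ nil :=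
    ne_nil_of_labels_eq_val ⟨N, by grind⟩ ht
  refine (count_swap (P' := fun t => (eoc t = m ∧ IsChild k N t) ∧ ¬ AreSiblings m (m + 1) t)
    ?_ ?_).trans (count_congr fun t ht => and_iff_left_of_imp fun h hchild => ?_)
  · simp only [Finset.mem_Icc]; omega
  · intro t ht hinc _
    have hnodup : (labels t).Nodup := ht ▸ Finset.nodup _
    have hchild := isChild_map_apply_iff (t := t) (Equiv.swap m (m + 1)).injective
      (a := k) (b := N)
    rw [Equiv.swap_apply_of_ne_of_ne (by omega) (by omega),
      Equiv.swap_apply_of_ne_of_ne (by omega) (by omega)] at hchild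
    have hsib (h : eoc t = m + 1) : ¬ AreSiblings m (m + 1) t :=
      ((eoc_eq_iff hnodup (hnil ht)).1 h).1.not_areSiblings hnodup (Nat.lt_succ_self m)
    have heoc (h : ¬ AreSiblings m (m + 1) t) :
        eoc (t.map (Equiv.swap m (m + 1))) = m ↔ eoc t = m + 1 := by
      rw [eoc_map_swap hnodup (hnil ht) hinc h, Equiv.swap_apply_eq_iff, Equiv.swap_apply_left]
    rw [areSiblings_map_swap, hchild]
    tauto
  · exact ((eoc_eq_iff (nodup_of_mem_completeTreesOn ht) (hnil ht.1)).1 h.1.1).2 _ hchild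

theorem IsLastBelow.mem_Ico {t : BinaryTree ℕ} {x : ℕ} (hx : IsLastBelow m x t)
    {S : Finset ℕ} (ht : t ∈ completeTreesOn S) (hzero : 0 ∉ S) : x ∈ Finset.Ico 1 m := by
  have hxS := (mem_labels_of_mem_completeTreesOn ht).1 hx.1.mem
  exact Finset.mem_Ico.2 ⟨Nat.one_le_iff_ne_zero.2 fun h => hzero (h ▸ hxS), hx.2.1⟩

theorem root?_ne_of_two_le {t : BinaryTree ℕ} (ht : t ∈ completeTreesOn (Finset.Icc 1 N))
    (hm : 2 ≤ m) : root? t ≠ some m := by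
  intro hroot
  have hmem := (mem_labels_of_mem_completeTreesOn ht).1 (mem_labels_of_root? hroot)
  have hone : 1 ∈ labels t := by
    rw [mem_labels_of_mem_completeTreesOn ht]
    simp only [Finset.mem_Icc] at hmem ⊢
    omega
  have := ht.2.1.root_le hroot hone
  omega

theorem eoc_eq_succ_and_isChild_iff {t : BinaryTree ℕ}
    (ht : t ∈ completeTreesOn (Finset.Icc 1 N)) (hm : 2 ≤ m) :
    eoc t = m + 1 ∧ IsChild m (m + 1) t ↔ ∃ x ∈ Finset.Ico 1 m,
      IsLastBelow m x t ∧ IsChild x m t ∧ IsChild m (m + 1) t ∧ IsLeaf (m + 1) t := by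
  have hnodup := nodup_of_mem_completeTreesOn ht
  have hiff := InMinChain.iff_exists_isLastBelow ht.2.1 (root?_ne_of_two_le ht hm)
  constructor
  · rintro ⟨heoc, hchild⟩
    obtain ⟨hchain, hleaf⟩ := (eoc_eq_iff hnodup (ne_nil_of_mem_labels hchild.mem_left)).1 heoc
    obtain hroot | ⟨p, hp, hpm⟩ := hchain.root_or_isMinChild
    · exact absurd hchild (not_isChild_root hnodup hroot)
    obtain rfl := hpm.1.parent_unique hnodup hchild
    obtain ⟨x, hx, hxm⟩ := hiff.1 hp
    exact ⟨x, hx.mem_Ico ht (by simp), hx, hxm, hchild, hleaf⟩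
  · rintro ⟨x, -, hx, hxm, hchild, hleaf⟩
    rw [eoc_eq_iff hnodup (ne_nil_of_mem_labels hchild.mem_left)]
    exact ⟨⟨(hiff.2 ⟨x, hx, hxm⟩).tail ⟨hchild, fun c hc => ht.2.1.lt hc⟩, hleaf⟩, hchild⟩

theorem eoc_eq_and_areSiblings_iff {t : BinaryTree ℕ}
    (ht : t ∈ completeTreesOn (Finset.Icc 1 N)) (hm : 2 ≤ m) :
    eoc t = m ∧ AreSiblings m (m + 1) t ↔ ∃ x ∈ Finset.Ico 1 m,
      IsLastBelow m x t ∧ IsChild x (m + 1) t ∧ IsChild x m t ∧ IsLeaf m t := by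
  have hnodup := nodup_of_mem_completeTreesOn ht
  have hiff := InMinChain.iff_exists_isLastBelow ht.2.1 (root?_ne_of_two_le ht hm)
  constructor
  · rintro ⟨heoc, p, hpm, hpm'⟩
    obtain ⟨hchain, hleaf⟩ := (eoc_eq_iff hnodup (ne_nil_of_mem_labels hpm.mem_left)).1 heoc
    obtain ⟨x, hx, hxm⟩ := hiff.1 hchain
    obtain rfl := hxm.parent_unique hnodup hpm
    exact ⟨x, hx.mem_Ico ht (by simp), hx, hpm', hxm, hleaf⟩
  · rintro ⟨x, -, hx, hxm', hxm, hleaf⟩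
    rw [eoc_eq_iff hnodup (ne_nil_of_mem_labels hxm.mem_left)]
    exact ⟨⟨hiff.2 ⟨x, hx, hxm⟩, hleaf⟩, x, hxm, hxm'⟩

theorem count_isLastBelow_sub {x : ℕ} (hx : x ∈ Finset.Ico 1 m) (hmk : m + 1 < k) (hkN : k < N) :
    count (Finset.Icc 1 N) (fun t => IsChild k N t ∧
        IsLastBelow m x t ∧ IsChild x m t ∧ IsChild m (m + 1) t ∧ IsLeaf (m + 1) t) -
      count (Finset.Icc 1 N) (fun t => IsChild k N t ∧
        IsLastBelow m x t ∧ IsChild x (m + 1) t ∧ IsChild x m t ∧ IsLeaf m t) =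
    2 * count (Finset.Icc 1 N \ {m, m + 1}) (fun t => IsChild k N t ∧ IsLastBelow m x t) -
      4 * count (Finset.Icc 1 N \ {m, m + 1})
        (fun t => IsChild k N t ∧ IsLastBelow m x t ∧ IsLeaf x t) := by
  rw [Finset.mem_Ico] at hx
  have hins : CanInsert (Finset.Icc 1 N \ {m, m + 1}) (Finset.Icc 1 N) m x m (m + 1) :=
    canInsert_sdiff (by grind) (by grind) (by grind) (by omega) hx.2
      le_rfl (by omega) (by omega)
  have hins' : CanInsert (Finset.Icc 1 N \ {m, m + 1}) (Finset.Icc 1 N) m x (m + 1) m :=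
    Finset.pair_comm m (m + 1) ▸ canInsert_sdiff (by grind) (by grind)
      (by grind) (by omega) hx.2 (by omega) le_rfl (by omega)
  have hignores {y z : ℕ} (hy : m ≤ y) (hy' : y ≤ m + 1) (hz : m ≤ z) (hz' : z ≤ m + 1) :
      IgnoresChildren (fun t => InMinChain t x ∧ IsChild k N t) x y z :=
    (ignoresChildren_inMinChain (by omega) (by omega) (by omega)).and
      (ignoresChildren_isChild (by omega) (by omega) (by omega))
  have hkey := count_growth_sub_count_push hins hins' (by omega)
    (hignores (by omega) (by omega) (by omega) (by omega))
    (hignores (by omega) (by omega) (by omega) (by omega))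
  have hlast (t : BinaryTree ℕ) : (InMinChain t x ∧ IsChild k N t) ∧ ChildrenGe m x t ↔
      IsChild k N t ∧ IsLastBelow m x t := by
    simp only [IsLastBelow, hx.2, true_and]
    tauto
  simpa only [hlast, and_assoc] using hkey

theorem count_eq_sum_isLastBelow {S : Finset ℕ} {P Q : BinaryTree ℕ → Prop}
    {R : ℕ → BinaryTree ℕ → Prop}
    (h : ∀ t ∈ completeTreesOn S, P t ↔ Q t ∧ ∃ x ∈ Finset.Ico 1 m, IsLastBelow m x t ∧ R x t) :
    count S P = ∑ x ∈ Finset.Ico 1 m, count S (fun t => Q t ∧ IsLastBelow m x t ∧ R x t) := by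
  rw [count_congr h]
  exact count_exists_eq_sum _ _ fun t ht x _ y _ hx hy => hx.1.unique ht.2.1 hy.1

theorem exists_mem_Ico_isLastBelow {S : Finset ℕ} {t : BinaryTree ℕ} (ht : t ∈ completeTreesOn S)
    (hzero : 0 ∉ S) (hone : 1 ∈ S) (hm : 2 ≤ m) : ∃ x ∈ Finset.Ico 1 m, IsLastBelow m x t := by
  obtain ⟨x, hx⟩ :=
    exists_isLastBelow ht.2.1 ((mem_labels_of_mem_completeTreesOn ht).2 hone) (Nat.lt_of_succ_le hm)
  exact ⟨x, hx.mem_Ico ht hzero, hx⟩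

theorem count_eoc_sub (hm : 2 ≤ m) (hmk : m + 1 < k) (hkN : k < N) :
    count (Finset.Icc 1 N) (fun t => (eoc t = m + 1 ∧ IsChild k N t) ∧ IsChild m (m + 1) t) -
      count (Finset.Icc 1 N)
        (fun t => (eoc t = m ∧ IsChild k N t) ∧ AreSiblings m (m + 1) t) =
    2 * count (Finset.Icc 1 N \ {m, m + 1}) (IsChild k N) -
      4 * count (Finset.Icc 1 N \ {m, m + 1}) (fun t => IsChild k N t ∧ eoc t < m) := by
  have hlast {t : BinaryTree ℕ} (ht : t ∈ completeTreesOn (Finset.Icc 1 N \ {m, m + 1})) :=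
    exists_mem_Ico_isLastBelow ht (by simp) (by grind) hm
  have hbase (t : BinaryTree ℕ) (ht : t ∈ completeTreesOn (Finset.Icc 1 N \ {m, m + 1})) :
      IsChild k N t ↔
        IsChild k N t ∧ ∃ x ∈ Finset.Ico 1 m, IsLastBelow m x t ∧ True := by
    simpa only [and_true] using (and_iff_left (hlast ht)).symm
  have hleaf (t : BinaryTree ℕ) (ht : t ∈ completeTreesOn (Finset.Icc 1 N \ {m, m + 1})) :
      IsChild k N t ∧ eoc t < m ↔
        IsChild k N t ∧ ∃ x ∈ Finset.Ico 1 m, IsLastBelow m x t ∧ IsLeaf x t := by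
    refine and_congr_right fun hchild => ?_
    have hiff {x : ℕ} := IsLastBelow.isLeaf_iff (nodup_of_mem_completeTreesOn ht) ht.2.1
      (ne_nil_of_mem_labels hchild.mem_left) (m := m) (x := x)
    have := hlast ht
    grind
  rw [count_eq_sum_isLastBelow (Q := IsChild k N)
      (R := fun x t => IsChild x m t ∧ IsChild m (m + 1) t ∧ IsLeaf (m + 1) t),
    count_eq_sum_isLastBelow (Q := IsChild k N)
      (R := fun x t => IsChild x (m + 1) t ∧ IsChild x m t ∧ IsLeaf m t),
    count_eq_sum_isLastBelow hbase, count_eq_sum_isLastBelow hleaf, Finset.mul_sum,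
    Finset.mul_sum, ← Finset.sum_sub_distrib, ← Finset.sum_sub_distrib]
  · refine Finset.sum_congr rfl fun x hx => ?_
    simpa only [and_true] using count_isLastBelow_sub hx hmk hkN
  · intro t ht
    rw [← eoc_eq_and_areSiblings_iff ht hm]
    tauto
  · intro t ht
    rw [← eoc_eq_succ_and_isChild_iff ht hm]
    tauto

theorem count_isChild_relabel (hm : 1 ≤ m) (hmk : m + 1 < k) (hkN : k < N)
    {Q Q' : BinaryTree ℕ → Prop}
    (hQ : ∀ t, labels t = (Finset.Icc 1 (N - 2)).val → LabelsIncrease t →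
      (Q t ↔ Q' (t.map fun b => if b < m then b else b + 2))) :
    count (Finset.Icc 1 N \ {m, m + 1}) (fun t => IsChild k N t ∧ Q' t) =
      count (Finset.Icc 1 (N - 2)) (fun t => IsChild (k - 2) (N - 2) t ∧ Q t) := by
  set σ : ℕ → ℕ := fun b => if b < m then b else b + 2 with hσ_def
  have hσ : StrictMono σ := by intro a b hab; grind
  have hσS : (Finset.Icc 1 (N - 2)).image σ = Finset.Icc 1 N \ {m, m + 1} := by
    ext a
    simp only [Finset.mem_image, Finset.mem_Icc, Finset.mem_sdiff, Finset.mem_insert,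
      Finset.mem_singleton, hσ_def]
    exact ⟨by grind, fun ha => ⟨if a < m then a else a - 2, by grind⟩⟩
  refine (count_relabel_strictMono hσ hσS fun t ht hinc => ?_).symm
  rw [hQ t ht hinc, ← isChild_map_apply_iff hσ.injective, show σ (k - 2) = k by grind,
    show σ (N - 2) = N by grind]

theorem eoc_map_lt_iff {t : BinaryTree ℕ} (hnodup : (labels t).Nodup) (hnil : t ≠ nil)
    (ht : LabelsIncrease t) : eoc (t.map fun b => if b < m then b else b + 2) < m ↔ eoc t < m := by
  have hσ : StrictMono fun b => if b < m then b else b + 2 := by intro a b hab; grind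
  rw [eoc_map hσ.injective hnodup hnil ht fun p b c _ _ _ hbc => hσ.monotone hbc]
  grind

theorem diffM_f (hm : 2 ≤ m) (hmk : m + 1 < k) (hkN : k < N) :
    diffM (f N) m k = 2 * count (Finset.Icc 1 (N - 2)) (IsChild (k - 2) (N - 2)) -
      4 * count (Finset.Icc 1 (N - 2)) (fun t => IsChild (k - 2) (N - 2) t ∧ eoc t < m) := by
  have hbase := count_isChild_relabel (by omega) hmk hkN (Q := fun _ => True)
    (Q' := fun _ => True) fun _ _ _ => Iff.rfl
  have hleaf := count_isChild_relabel (by omega) hmk hkN (Q := fun t => eoc t < m)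
    (Q' := fun t => eoc t < m) fun t ht hinc => (eoc_map_lt_iff (ht ▸ Finset.nodup _)
      (ne_nil_of_labels_eq_val ⟨1, by grind⟩ ht) hinc).symm
  simp only [and_true] at hbase
  rw [diffM, f_eq_count (by omega) (by omega), f_eq_count (by omega) (by omega),
    count_eq_add _ (IsChild m (m + 1)),
    count_eq_add (fun t => eoc t = m ∧ IsChild k N t) (AreSiblings m (m + 1)),
    count_eoc_succ_not_isChild (by omega) hmk hkN, ← hbase, ← hleaf, ← count_eoc_sub hm hmk hkN]
  ring

theorem diffM_diffM_f (hm : 2 ≤ m) (hmk : m + 3 ≤ k) (hkN : k < N) :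
    diffM (diffM (f N)) m k + 4 * f (N - 2) m (k - 2) = 0 := by
  have hsplit : count (Finset.Icc 1 (N - 2))
        (fun t => IsChild (k - 2) (N - 2) t ∧ eoc t < m + 1) =
      f (N - 2) m (k - 2) +
        count (Finset.Icc 1 (N - 2)) (fun t => IsChild (k - 2) (N - 2) t ∧ eoc t < m) := by
    rw [f_eq_count (by omega) (by omega), count_eq_add _ (fun t => eoc t = m)]
    congr 1 <;> refine count_congr fun t _ => ?_ <;> grind
  rw [diffM, diffM_f (by omega) (by omega) hkN, diffM_f hm (by omega) hkN, hsplit]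
  ring

end DiffM

end SecantTree

theorem theorem1p1_general :
    (∀ N m k : ℕ, 2 ≤ m → m + 3 ≤ k → k + 1 ≤ N →
      SecantTree.diffM (SecantTree.diffM (SecantTree.f N)) m k
        + 4 * SecantTree.f (N - 2) m (k - 2) = 0) ∧
    (∀ N m k : ℕ, m + 1 ≤ k → k + 3 ≤ N →
      SecantTree.diffK (SecantTree.diffK (SecantTree.f N)) m k
        + 4 * SecantTree.f (N - 2) m k = 0) :=
  ⟨fun _ _ _ hm hmk hkN => SecantTree.diffM_diffM_f hm hmk hkN,
    fun _ _ _ hmk hkN => SecantTree.diffK_diffK_f hmk hkN⟩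

theorem theorem1p1 :
    (∀ n m k : ℕ, 2 ≤ m → m + 3 ≤ k → k + 1 ≤ 2 * n →
      SecantTree.diffM (SecantTree.diffM (SecantTree.f (2 * n))) m k
        + 4 * SecantTree.f (2 * n - 2) m (k - 2) = 0) ∧
    (∀ n m k : ℕ, 2 ≤ m → m + 1 ≤ k → k + 3 ≤ 2 * n →
      SecantTree.diffK (SecantTree.diffK (SecantTree.f (2 * n))) m k
        + 4 * SecantTree.f (2 * n - 2) m k = 0) :=
  ⟨fun n => theorem1p1_general.1 (2 * n), fun n m k _ => theorem1p1_general.2 (2 * n) m k⟩
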